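/- Let $K$ be a number field, and let $C$ and $C'$ be curves of genus $0$ over $K$, where a curve over $K$ means a smooth projective geometrically connected curve over $K$, and its genus is $\dim_K H^1(C,\mathcal O_C)$. Let $f\colon C\to C'$ be a nonconstant morphism over $K$, and suppose that $C'(K)=\emptyset$. Then $C$ and $C'$ are isomorphic over $K$, and the degree $\deg f=[K(C):K(C')]$ is odd. -/

import Mathlib

open CategoryTheory AlgebraicGeometry

universe u

noncomputable section

/-- The structure sheaf `𝒪_X` of a scheme, viewed as a sheaf of abelian groups on the Zariski
site of opens of `X`. -/
def structureAbSheaf (X : Scheme.{u}) :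
    Sheaf (Opens.grothendieckTopology X) AddCommGrpCat.{u} :=
  (sheafCompose (Opens.grothendieckTopology X)
    (forget₂ CommRingCat.{u} RingCat.{u} ⋙ forget₂ RingCat.{u} AddCommGrpCat.{u})).obj X.sheaf

/-- Multiplication by a global section `s` of `𝒪_X`, as an endomorphism of `𝒪_X`: on an open `U` it
is `t ↦ s|_U * t`. -/
def mulSection (X : Scheme.{u}) (s : Γ(X, ⊤)) : structureAbSheaf X ⟶ structureAbSheaf X :=
  ⟨{ app := fun U => AddCommGrpCat.ofHom
        (AddMonoidHom.mulLeft (X.presheaf.map (homOfLE le_top : U.unop ⟶ ⊤).op s :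
          X.presheaf.obj U))
     naturality := by
      intro U V i
      ext (t : X.presheaf.obj U)
      change (X.presheaf.map (homOfLE le_top : V.unop ⟶ ⊤).op s : X.presheaf.obj V) *
          X.presheaf.map i t =
        X.presheaf.map i ((X.presheaf.map (homOfLE le_top : U.unop ⟶ ⊤).op s :
          X.presheaf.obj U) * t)
      rw [map_mul, ← ConcreteCategory.comp_apply, ← X.presheaf.map_comp]
      rfl }⟩

/-- The action of global sections on the cohomology group `Hⁿ(X, 𝒪_X)`, as a ring homomorphism
into its additive endomorphisms. -/
def sectionsToEnd (X : Scheme.{u}) (n : ℕ) :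
    Γ(X, ⊤) →+* AddMonoid.End ((structureAbSheaf X).H n) where
  toFun s := Sheaf.H.map (mulSection X s) n
  map_one' := by
    have h : mulSection X 1 = 𝟙 _ := by
      ext U (t : X.presheaf.obj U)
      change (X.presheaf.map (homOfLE le_top : U.unop ⟶ ⊤).op 1 : X.presheaf.obj U) * t = t
      rw [map_one, one_mul]
    ext x
    rw [h]
    exact Sheaf.H.map_id_apply x
  map_mul' a b := by
    have h : mulSection X (a * b) = mulSection X b ≫ mulSection X a := by
      ext U (t : X.presheaf.obj U)
      change (X.presheaf.map (homOfLE le_top : U.unop ⟶ ⊤).op (a * b) : X.presheaf.obj U) * t =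
        X.presheaf.map (homOfLE le_top : U.unop ⟶ ⊤).op a *
          (X.presheaf.map (homOfLE le_top : U.unop ⟶ ⊤).op b * t)
      rw [map_mul, mul_assoc]
    ext x
    rw [h]
    exact Sheaf.H.map_comp_apply _ _ x
  map_zero' := by
    have h : mulSection X 0 = 0 := by
      ext U (t : X.presheaf.obj U)
      change (X.presheaf.map (homOfLE le_top : U.unop ⟶ ⊤).op 0 : X.presheaf.obj U) * t = 0
      rw [map_zero, zero_mul]
    ext x
    rw [h]
    change Sheaf.H.map 0 n x = 0
    rw [Sheaf.H.map_apply, Abelian.Ext.mk₀_zero, Abelian.Ext.comp_zero]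
  map_add' a b := by
    have h : mulSection X (a + b) = mulSection X a + mulSection X b := by
      ext U (t : X.presheaf.obj U)
      change (X.presheaf.map (homOfLE le_top : U.unop ⟶ ⊤).op (a + b) : X.presheaf.obj U) * t =
        X.presheaf.map (homOfLE le_top : U.unop ⟶ ⊤).op a * t +
          X.presheaf.map (homOfLE le_top : U.unop ⟶ ⊤).op b * t
      rw [map_add, add_mul]
    ext x
    rw [h]
    exact Sheaf.H.map_add_apply _ _ x

variable {K : Type u} [Field K]

/-- The constants: the ring homomorphism `K → Γ(X, 𝒪_X)` given by the structure morphism of a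
`K`-scheme. -/
def constants (X : Over (Spec (.of K))) : K →+* Γ(X.left, ⊤) :=
  ((Scheme.ΓSpecIso (.of K)).inv ≫ X.hom.appTop).hom

/-- The `K`-vector space structure on `Hⁿ(X, 𝒪_X)`, for a `K`-scheme `X`. -/
abbrev cohomologyModule (X : Over (Spec (.of K))) (n : ℕ) :
    Module K ((structureAbSheaf X.left).H n) :=
  Module.compHom _ ((sectionsToEnd X.left n).comp (constants X))

/-- The genus `dim_K H¹(X, 𝒪_X)` of a curve `X` over `K`. -/
def genus (X : Over (Spec (.of K))) : Cardinal.{u} :=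
  letI := cohomologyModule X 1
  Module.rank K ((structureAbSheaf X.left).H 1)

/-- Smooth projective geometrically connected curves over `K`: integral schemes, proper and smooth
of relative dimension one over `K`, and geometrically connected. (A curve over a field is
projective if and only if it is proper.) -/
class IsSmoothProjectiveCurve (X : Over (Spec (.of K))) : Prop where
  isIntegral : AlgebraicGeometry.IsIntegral X.left
  isProper : IsProper X.hom
  smooth : SmoothOfRelativeDimension 1 X.hom
  geometricallyConnected : GeometricallyConnected X.hom

attribute [instance] IsSmoothProjectiveCurve.isIntegral

/-- A `K`-rational point of a `K`-scheme. -/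
abbrev RationalPoint (X : Over (Spec (.of K))) : Type u :=
  Over.mk (𝟙 (Spec (.of K))) ⟶ X

/-- A morphism is nonconstant if its image is not a single point. -/
def IsNonconstant {X Y : Over (Spec (.of K))} (f : X ⟶ Y) : Prop :=
  ¬ ∃ y : Y.left, ∀ x : X.left, f.left x = y

/-- The degree of a nonconstant morphism of curves `f : X ⟶ Y`: the degree `[K(X) : K(Y)]` of the
extension of function fields, given by the map on stalks of `f` at the generic point of `X`
(which `f` maps to the generic point of `Y`). -/
def curveDegree {X Y : Over (Spec (.of K))} [IrreducibleSpace X.left] (f : X ⟶ Y) : ℕ :=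
  letI : Algebra (Y.left.presheaf.stalk (f.left (genericPoint X.left))) X.left.functionField :=
    (f.left.stalkMap (genericPoint X.left)).hom.toAlgebra
  Module.finrank (Y.left.presheaf.stalk (f.left (genericPoint X.left))) X.left.functionField

end

/-! ### Places of a curve of genus zero and functions with poles at one place -/

namespace CurveModel

open IsLocalRing Module

variable {K L ι : Type*} [Field K] [Field L] [Algebra K L]

/-! Both curves turn out to be conics split by the same quadratic field `K(√a)`, and the theorem
becomes a computation with norms from `K(√a)`.

A rational point of `C` would map to one of `C'`, so neither curve has any. On each curve, `H¹(𝒪) =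
0` lets every principal part at a closed point be realised by a global function. As global regular
functions are constant, the functions with a pole of order at most `k` at `P` alone form a space of
dimension `k deg P + 1` (`finrank_poleSpace`). Linear functionals on the function field that kill
the functions regular away from `P` play the role of differentials. If `deg P ≥ 3`, two independent
functionals with at most a simple pole at `P` have a ratio whose denominators cut out a subscheme of
degree at most `deg P - 2`, so some place has that degree or less (`exists_place_of_three_le`).
Descent yields a place `P` of degree 2 on `C`. The residue field of `f(P)` embeds in that of `P` and
is not `K`, so the two are the same field `K(√a)`. Functions with a simple pole at such a place
generate the function field and satisfy `y² = a x² + b` (`exists_isConic`); on `C'` the equation is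
`y'² = a x'² + b'`.

Let `L ⊇ L'` be the function fields of `C` and `C'`, and `σ` the conjugation of `M = L(√a)` over
`L`. Then `z = y - √a x` is a parameter of `M` over `K(√a)`, with `z σ(z) = b`, and `w = y' - √a x'`
satisfies `w σ(w) = b'`. Write `w = p(z) / q(z)` in lowest terms, of degree `d = [L : L']`.
Substituting `σ(z) = b / z` into `w σ(w) = b'` and using coprimality shows that `b' b ^ d` is a norm
from `K(√a)` (`exists_mul_pow_eq_norm`). If `d` were even, `b'` would be a norm, which gives a
rational point on `C'`. So `d` is odd and `b' / b` is a norm; multiplying `y + √a x` by an element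
of that norm turns one conic into the other (`IsConic.odd_finrank`). Finally, smooth proper curves
with isomorphic function fields are isomorphic. -/

/-- The places of a complete curve of genus `0` with function field `L` and field of constants `K`:
a family of discrete valuation rings of `L` with finite residue fields, consisting of all the
nontrivial valuation rings of `L` over `K`, whose common elements are the constants, and for which
every principal part at a single place is the principal part of a global function. -/
structure IsGenusZeroModel (O : ι → Subalgebra K L) [∀ p, IsDiscreteValuationRing (O p)] :
    Prop where
  isFractionRing : ∀ p, IsFractionRing (O p) L
  finite : ∀ p, Module.Finite K (ResidueField (O p))
  const : ∀ g, (∀ p, g ∈ O p) → g ∈ (algebraMap K L).range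
  principalPart : ∀ p g, ∃ h, (∀ q, q ≠ p → h ∈ O q) ∧ g - h ∈ O p
  proper : ∀ R : ValuationSubring L, (∀ c, algebraMap K L c ∈ R) → R ≠ ⊤ →
    ∃ p, ∀ g, g ∈ R ↔ g ∈ O p

/-- The ring of functions regular away from the place `P`. -/
def regularAway (O : ι → Subalgebra K L) (P : ι) : Subalgebra K L := ⨅ q : {q // q ≠ P}, O q

lemma mem_regularAway {O : ι → Subalgebra K L} {P : ι} {g : L} :
    g ∈ regularAway O P ↔ ∀ q, q ≠ P → g ∈ O q := by
  simp [regularAway, Algebra.mem_iInf]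

set_option linter.unusedSectionVars false

section DVR

variable {S : Subalgebra K L} [IsDiscreteValuationRing S] {t : S} (ht : Irreducible t)
include ht

lemma coe_ne_zero : (t : L) ≠ 0 := fun h => ht.ne_zero (Subtype.ext h)

lemma residue_eq_zero_iff {g : L} (hg : g ∈ S) :
    residue S ⟨g, hg⟩ = 0 ↔ ∃ h ∈ S, g = t * h := by
  rw [IsLocalRing.residue_eq_zero_iff, ht.maximalIdeal_eq, Ideal.mem_span_singleton]
  constructor
  · rintro ⟨h, hh⟩
    exact ⟨h, h.2, congrArg Subtype.val hh⟩
  · rintro ⟨h, hh, e⟩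
    exact ⟨⟨h, hh⟩, Subtype.ext e⟩

lemma exists_pow_mul_mem (hS : IsFractionRing S L) (g : L) : ∃ k : ℕ, (t : L) ^ k * g ∈ S := by
  obtain ⟨a, b, hb, rfl⟩ := IsFractionRing.div_surjective (A := S) g
  have hb0 : b ≠ 0 := nonZeroDivisors.ne_zero hb
  obtain ⟨n, v, hv⟩ := IsDiscreteValuationRing.associated_pow_irreducible hb0 ht
  refine ⟨n, ?_⟩
  have h1 : (t : L) ^ n = (b : L) * (v : S) := by
    have := congrArg (Subtype.val) hv
    simpa using this.symm
  have hb1 : (b : L) ≠ 0 := fun h => hb0 (Subtype.ext h)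
  have : (t : L) ^ n * (algebraMap S L a / algebraMap S L b) = ((a * v : S) : L) := by
    rw [h1]
    change (b : L) * (v : S) * ((a : L) / (b : L)) = (a : L) * ((v : S) : L)
    field_simp
  rw [this]
  exact Subtype.property _

lemma inv_mem_of_notMem (hS : IsFractionRing S L) {g : L} (hg : g ∉ S) :
    ∃ h ∈ S, g⁻¹ = t * h := by
  obtain ⟨⟨h, e⟩⟩ | h := ValuationRing.isInteger_or_isInteger S (K := L) g
  · exact absurd (e ▸ h.2) hg
  · obtain ⟨h, e⟩ := h
    have hm : g⁻¹ ∈ S := e ▸ h.2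
    refine (residue_eq_zero_iff ht hm).1 ?_
    rw [IsLocalRing.residue_eq_zero_iff, IsLocalRing.mem_maximalIdeal]
    intro hu
    obtain ⟨v, hv⟩ := hu.exists_right_inv
    apply hg
    have h1 : g⁻¹ * (v : L) = 1 := congrArg Subtype.val hv
    have : g = v := by
      have hg0 : g ≠ 0 := fun h => hg (h ▸ S.zero_mem)
      field_simp at h1
      exact h1.symm
    rw [this]; exact v.2

end DVR

section PoleSpace

variable (O : ι → Subalgebra K L) [∀ p, IsDiscreteValuationRing (O p)] (P : ι) (t : O P)

/-- The functions regular away from `P` with a pole of order at most `k` at `P`. -/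
def poleSpace (k : ℕ) : Submodule K L :=
  Subalgebra.toSubmodule (regularAway O P) ⊓
    (Subalgebra.toSubmodule (O P)).comap (LinearMap.mulLeft K ((t : L) ^ k))

variable {O P t}

lemma mem_poleSpace {k : ℕ} {g : L} :
    g ∈ poleSpace O P t k ↔ g ∈ regularAway O P ∧ (t : L) ^ k * g ∈ O P := Iff.rfl

lemma poleSpace_mono {j k : ℕ} (h : j ≤ k) : poleSpace O P t j ≤ poleSpace O P t k := by
  intro g hg
  rw [mem_poleSpace] at hg ⊢
  refine ⟨hg.1, ?_⟩
  have : (t : L) ^ k * g = (t : L) ^ (k - j) * ((t : L) ^ j * g) := by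
    rw [← mul_assoc, ← pow_add, Nat.sub_add_cancel h]
  rw [this]
  exact mul_mem (pow_mem t.2 _) hg.2

lemma mul_mem_poleSpace {j k : ℕ} {g h : L} (hg : g ∈ poleSpace O P t j)
    (hh : h ∈ poleSpace O P t k) : g * h ∈ poleSpace O P t (j + k) := by
  rw [mem_poleSpace] at *
  refine ⟨mul_mem hg.1 hh.1, ?_⟩
  have := mul_mem hg.2 hh.2
  convert this using 1
  ring

lemma algebraMap_mem_poleSpace (c : K) (k : ℕ) : algebraMap K L c ∈ poleSpace O P t k :=
  poleSpace_mono (Nat.zero_le k) (mem_poleSpace.2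
    ⟨Subalgebra.algebraMap_mem _ c, by simp⟩)

variable (O P t) in
/-- The leading coefficient at `P` of a function with a pole of order at most `k`. -/
noncomputable def leadingCoeff (k : ℕ) : poleSpace O P t k →ₗ[K] ResidueField (O P) :=
  (IsScalarTower.toAlgHom K (O P) (ResidueField (O P))).toLinearMap ∘ₗ
    (LinearMap.codRestrict (Subalgebra.toSubmodule (O P))
      (LinearMap.mulLeft K ((t : L) ^ k) ∘ₗ (poleSpace O P t k).subtype) fun g => g.2.2)

lemma leadingCoeff_apply {k : ℕ} (g : poleSpace O P t k) :
    leadingCoeff O P t k g = residue (O P) ⟨(t : L) ^ k * g, (mem_poleSpace.1 g.2).2⟩ := rfl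

variable (ht : Irreducible t)
include ht

lemma leadingCoeff_succ_eq_zero_iff {k : ℕ} (g : poleSpace O P t (k + 1)) :
    leadingCoeff O P t (k + 1) g = 0 ↔ (g : L) ∈ poleSpace O P t k := by
  rw [leadingCoeff_apply, residue_eq_zero_iff ht, mem_poleSpace]
  have h0 := coe_ne_zero ht
  constructor
  · rintro ⟨h, hh, e⟩
    refine ⟨g.2.1, ?_⟩
    have : (t : L) ^ k * g = h := mul_left_cancel₀ h0 (by rw [← e]; ring)
    rwa [this]
  · rintro ⟨-, h⟩
    exact ⟨_, h, by ring⟩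

variable (hO : IsGenusZeroModel O)
include hO

lemma exists_mem_poleSpace (g : L) : ∃ k, ∀ h ∈ regularAway O P, g - h ∈ O P →
    h ∈ poleSpace O P t k := by
  obtain ⟨k, hk⟩ := exists_pow_mul_mem ht (hO.isFractionRing P) g
  refine ⟨k, fun h hh hgh => mem_poleSpace.2 ⟨hh, ?_⟩⟩
  have : (t : L) ^ k * h = (t : L) ^ k * g - (t : L) ^ k * (g - h) := by ring
  rw [this]
  exact sub_mem hk (mul_mem (pow_mem t.2 _) hgh)

lemma exists_mem_poleSpace_of_mem {a : L} (ha : a ∈ regularAway O P) :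
    ∃ k, a ∈ poleSpace O P t k := by
  obtain ⟨k, hk⟩ := exists_mem_poleSpace ht hO a
  exact ⟨k, hk a ha (by simp)⟩

omit ht in
lemma mem_poleSpace_zero_iff {g : L} :
    g ∈ poleSpace O P t 0 ↔ g ∈ (algebraMap K L).range := by
  constructor
  · intro hg
    rw [mem_poleSpace, mem_regularAway] at hg
    refine hO.const g fun p => ?_
    by_cases hp : p = P
    · subst hp; simpa using hg.2
    · exact hg.1 p hp
  · rintro ⟨c, rfl⟩
    exact algebraMap_mem_poleSpace c 0

/-- The vanishing of `H¹` enters here: the principal part of `v / t ^ (k + 1)` is realised by a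
global `h`, and `t ^ (k + 1) * h` differs from `v` by a multiple of `t`. For order 0 this would
fail, since only constants are available. -/
lemma leadingCoeff_surjective (k : ℕ) : Function.Surjective (leadingCoeff O P t (k + 1)) := by
  intro c
  obtain ⟨v, rfl⟩ := residue_surjective (R := O P) c
  have h0 := coe_ne_zero ht
  obtain ⟨h, hh, hg⟩ := hO.principalPart P ((v : L) / (t : L) ^ (k + 1))
  have key : (t : L) ^ (k + 1) * h = v - t * ((t : L) ^ k * ((v : L) / (t : L) ^ (k + 1) - h)) := by
    field_simp
    ring
  have hm : (t : L) ^ (k + 1) * h ∈ O P := by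
    rw [key]
    exact sub_mem v.2 (mul_mem t.2 (mul_mem (pow_mem t.2 _) hg))
  refine ⟨⟨h, mem_regularAway.2 hh, hm⟩, ?_⟩
  rw [leadingCoeff_apply, ← sub_eq_zero, ← map_sub]
  have : residue (O P) ⟨(t : L) ^ (k + 1) * h - v, sub_mem hm v.2⟩ = 0 :=
    (residue_eq_zero_iff ht _).2 ⟨-((t : L) ^ k * ((v : L) / (t : L) ^ (k + 1) - h)),
      neg_mem (mul_mem (pow_mem t.2 _) hg), by rw [key]; ring⟩
  exact this

/-- Riemann–Roch for `kP` in genus zero: the pole filtration starts with the constants, and each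
further step adds a copy of the residue field through the leading coefficient. -/
lemma finrank_poleSpace (k : ℕ) : FiniteDimensional K (poleSpace O P t k) ∧
    finrank K (poleSpace O P t k) = k * finrank K (ResidueField (O P)) + 1 := by
  have := hO.finite P
  induction k with
  | zero =>
    have h : poleSpace O P t 0 = Submodule.span K {(1 : L)} := by
      ext g
      rw [mem_poleSpace_zero_iff hO, Submodule.mem_span_singleton]
      simp [Algebra.smul_def]
    rw [h]
    exact ⟨inferInstance, by simp [finrank_span_singleton]⟩
  | succ k ih =>
    obtain ⟨ih1, ih2⟩ := ih
    have hle := poleSpace_mono (t := t) (Nat.le_succ k)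
    have hker : (leadingCoeff O P t (k + 1)).ker =
        (poleSpace O P t k).comap (poleSpace O P t (k + 1)).subtype := by
      ext g
      exact leadingCoeff_succ_eq_zero_iff ht g
    have e := Submodule.comapSubtypeEquivOfLe hle
    have hkf : FiniteDimensional K (leadingCoeff O P t (k + 1)).ker := by
      rw [hker]; exact Module.Finite.equiv e.symm
    have hf : FiniteDimensional K (poleSpace O P t (k + 1)) :=
      have := Module.Finite.equiv ((leadingCoeff O P t (k + 1)).quotKerEquivOfSurjective
        (leadingCoeff_surjective ht hO k)).symm
      Module.Finite.of_submodule_quotient (leadingCoeff O P t (k + 1)).ker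
    refine ⟨hf, ?_⟩
    have h1 := (leadingCoeff O P t (k + 1)).finrank_range_add_finrank_ker
    rw [LinearMap.range_eq_top.2 (leadingCoeff_surjective ht hO k), finrank_top, hker,
      e.finrank_eq, ih2] at h1
    rw [← h1]; ring

end PoleSpace

end CurveModel

/-! ### Maximal ideals of the affine ring away from `P` -/

namespace CurveModel

open IsLocalRing Module

set_option linter.unusedSectionVars false

variable {K L ι : Type*} [Field K] [Field L] [Algebra K L]
variable {O : ι → Subalgebra K L} [∀ p, IsDiscreteValuationRing (O p)] {P : ι} {t : O P}

lemma regularAway_le {q : ι} (hq : q ≠ P) : regularAway O P ≤ O q :=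
  fun _ hg => mem_regularAway.1 hg q hq

/-- Evaluation at a place `q ≠ P` of the functions regular away from `P`. -/
noncomputable def evalAt {q : ι} (hq : q ≠ P) : regularAway O P →ₐ[K] ResidueField (O q) :=
  (IsScalarTower.toAlgHom K (O q) (ResidueField (O q))).comp
    (Subalgebra.inclusion (regularAway_le hq))

lemma evalAt_apply {q : ι} (hq : q ≠ P) (a : regularAway O P) :
    evalAt (O := O) hq a = residue (O q) ⟨a, regularAway_le hq a.2⟩ := rfl

section

variable (hO : IsGenusZeroModel O)
include hO

lemma mem_range_of_mem_of_mem {g : L} (hA : g ∈ regularAway O P) (hP : g ∈ O P) :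
    g ∈ (algebraMap K L).range := by
  refine hO.const g fun p => ?_
  by_cases hp : p = P
  · exact hp ▸ hP
  · exact mem_regularAway.1 hA p hp

/-- To hit the residue of `v`, take `h` with the principal part of `v / a` at `q` and no other
poles. Since `a` vanishes at `q`, it turns the regular difference `v / a - h` into something of
residue zero, so `a * h` has the residue of `v` and is still regular away from `P`. -/
lemma evalAt_surjective {q : ι} (hq : q ≠ P) {a : regularAway O P} (ha : a ≠ 0)
    (h0 : evalAt (O := O) hq a = 0) : Function.Surjective (evalAt (O := O) hq) := by
  intro c
  obtain ⟨v, rfl⟩ := residue_surjective (R := O q) c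
  have ha0 : (a : L) ≠ 0 := fun h => ha (Subtype.ext h)
  obtain ⟨h, hh, hg⟩ := hO.principalPart q ((v : L) / a)
  have key : (a : L) * h = v - a * ((v : L) / a - h) := by field_simp; ring
  have haq := regularAway_le hq a.2
  have hmq : (a : L) * h ∈ O q := by
    rw [key]; exact sub_mem v.2 (mul_mem haq hg)
  have hm : (a : L) * h ∈ regularAway O P := by
    refine mem_regularAway.2 fun p hp => ?_
    by_cases hpq : p = q
    · exact hpq ▸ hmq
    · exact mul_mem (regularAway_le hp a.2) (hh p hpq)
  refine ⟨⟨_, hm⟩, ?_⟩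
  have e : (⟨(a : L) * h, hmq⟩ : O q) = v - ⟨a, haq⟩ * ⟨(v : L) / a - h, hg⟩ :=
    Subtype.ext key
  rw [evalAt_apply] at h0 ⊢
  rw [e, map_sub, map_mul, h0, zero_mul, sub_zero]

variable (ht : Irreducible t)
include ht

lemma exists_leadingCoeff_eq_one : ∃ x ∈ regularAway O P, ∃ h : (t : L) * x ∈ O P,
    residue (O P) ⟨t * x, h⟩ = 1 := by
  obtain ⟨x, hx⟩ := leadingCoeff_surjective ht hO 0 1
  have h := (mem_poleSpace.1 x.2).2
  have h' : (t : L) * x ∈ O P := by simpa using h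
  refine ⟨x, (mem_poleSpace.1 x.2).1, h', ?_⟩
  rw [leadingCoeff_apply] at hx
  rw [← hx]
  congr 2
  simp

lemma not_regularAway_le : ¬ regularAway O P ≤ O P := by
  intro hle
  obtain ⟨x, hx, h, h1⟩ := exists_leadingCoeff_eq_one hO ht
  have := (residue_eq_zero_iff ht h).2 ⟨x, hle hx, rfl⟩
  rw [this] at h1
  exact zero_ne_one h1

/-- The nonzero maximal ideals of the ring of functions regular away from `P` are the places
other than `P`. -/
lemma exists_place_of_isMaximal (I : Ideal (regularAway O P)) [hI : I.IsMaximal] (hb : I ≠ ⊥) :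
    ∃ q, ∃ hq : q ≠ P, RingHom.ker (evalAt (O := O) hq) = I ∧
      Nonempty ((regularAway O P ⧸ I) ≃ₐ[K] ResidueField (O q)) := by
  -- A valuation ring containing the affine ring with `I` inside its nonunits is nontrivial because
  -- `I ≠ ⊥`, hence is a place `q`. It is not `P`, where the affine ring has poles.
  obtain ⟨R, hR, hIR⟩ := Ideal.image_subset_nonunits_valuationSubring
    (A := (regularAway O P).toSubring) I hI.ne_top
  obtain ⟨a, haI, ha⟩ := Submodule.exists_mem_ne_zero_of_ne_bot hb
  have ha0 : (a : L) ≠ 0 := fun h => ha (Subtype.ext h)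
  have hn : ∀ b ∈ I, (b : L) ∈ R.nonunits := fun b hb => hIR ⟨b, hb, rfl⟩
  have hRt : R ≠ ⊤ := by
    rintro rfl
    have := hn a haI
    rw [ValuationSubring.mem_nonunits_iff_or] at this
    rcases this with h | h
    · exact ha0 h
    · exact h trivial
  obtain ⟨q, hq⟩ := hO.proper R (fun c => hR ((regularAway O P).algebraMap_mem c)) hRt
  have hqP : q ≠ P := by
    rintro rfl
    exact not_regularAway_le hO ht fun g hg => (hq g).1 (hR hg)
  have hker : I ≤ RingHom.ker (evalAt (O := O) hqP) := by
    intro b hb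
    rw [RingHom.mem_ker, evalAt_apply, IsLocalRing.residue_eq_zero_iff, mem_maximalIdeal]
    intro hu
    obtain ⟨v, hv⟩ := hu.exists_right_inv
    have h1 : (b : L) * v = 1 := congrArg Subtype.val hv
    have := hn b hb
    rw [ValuationSubring.mem_nonunits_iff_or] at this
    rcases this with h | h
    · rw [h, zero_mul] at h1
      exact zero_ne_one h1
    · exact h ((hq _).2 (by rw [inv_eq_of_mul_eq_one_right h1]; exact v.2))
  have hker' : RingHom.ker (evalAt (O := O) hqP) = I :=
    (hI.eq_of_le (RingHom.ker_ne_top _) hker).symm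
  refine ⟨q, hqP, hker', ⟨?_⟩⟩
  have hsurj := evalAt_surjective hO hqP ha (hker haI)
  exact (Ideal.quotientEquivAlgOfEq K hker'.symm).trans
    (Ideal.quotientKerAlgEquivOfSurjective hsurj)

/-- A linear functional on the residue field at `P` that kills the constants extends to a functional
on `L` killing the functions regular away from `P`. -/
lemma exists_functional (l : ResidueField (O P) →ₗ[K] K) (hl : l 1 = 0) :
    ∃ ψ : L →ₗ[K] K, (∀ a ∈ regularAway O P, ψ a = 0) ∧
      ∀ g, ∀ hg : g ∈ O P, ψ g = l (residue (O P) ⟨g, hg⟩) := by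
  let A := Subalgebra.toSubmodule (regularAway O P)
  let f : O P →ₗ[K] L ⧸ A := A.mkQ ∘ₗ (O P).val.toLinearMap
  let l' : O P →ₗ[K] K := l ∘ₗ (IsScalarTower.toAlgHom K (O P) (ResidueField (O P))).toLinearMap
  -- The functional on `O P` extends to `L / A` exactly when it kills `O P ∩ A`, which consists of
  -- the constants.
  have hl' : l' ∈ f.dualMap.range := by
    rw [LinearMap.range_dualMap_eq_dualAnnihilator_ker, Submodule.mem_dualAnnihilator]
    intro g hg
    have hg' : (g : L) ∈ A := by
      rw [LinearMap.mem_ker] at hg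
      exact (Submodule.Quotient.mk_eq_zero A).1 hg
    obtain ⟨c, hc⟩ := mem_range_of_mem_of_mem hO hg' g.2
    have hgc : g = algebraMap K (O P) c := Subtype.ext hc.symm
    rw [hgc]
    change l (algebraMap K (ResidueField (O P)) c) = 0
    rw [Algebra.algebraMap_eq_smul_one, map_smul, hl, smul_zero]
  obtain ⟨ψ, hψ⟩ := hl'
  refine ⟨ψ ∘ₗ A.mkQ, fun a ha => ?_, fun g hg => ?_⟩
  · have : A.mkQ a = 0 := (Submodule.Quotient.mk_eq_zero A).2 ha
    rw [LinearMap.comp_apply, this, map_zero]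
  · exact LinearMap.congr_fun hψ ⟨g, hg⟩

end

/-! ### Functionals as differentials, and descent to a place of degree two -/

variable (O P t) in
/-- The linear functionals on `L` that kill the functions regular away from `P`, and those with
a zero of order at least `n` at `P`. -/
def functionals (n : ℕ) : Submodule K (L →ₗ[K] K) where
  carrier := {ψ | (∀ a ∈ regularAway O P, ψ a = 0) ∧ ∀ g ∈ O P, ψ ((t : L) ^ n * g) = 0}
  add_mem' h h' := ⟨fun a ha => by simp [h.1 a ha, h'.1 a ha],
    fun g hg => by simp [h.2 g hg, h'.2 g hg]⟩
  zero_mem' := by simp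
  smul_mem' c _ h := ⟨fun a ha => by simp [h.1 a ha], fun g hg => by simp [h.2 g hg]⟩

/-- The model to keep in mind is `g ↦ Res_P (g ω)` with `ω` regular away from `P`: killing `t ^ n
O_P` bounds the pole of `ω` at `P` by `n`. Multiplying by a function with a pole of order at most
`k` raises the bound from 1 to `k + 1`. -/
lemma comp_mulLeft_mem_functionals {k : ℕ} {ψ : L →ₗ[K] K} (hψ : ψ ∈ functionals O P t 1) {a : L}
    (ha : a ∈ poleSpace O P t k) :
    ψ ∘ₗ LinearMap.mulLeft K a ∈ functionals O P t (k + 1) := by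
  rw [mem_poleSpace] at ha
  refine ⟨fun b hb => hψ.1 _ (mul_mem ha.1 hb), fun g hg => ?_⟩
  have := hψ.2 _ (mul_mem ha.2 hg)
  rw [← this, LinearMap.comp_apply, LinearMap.mulLeft_apply]
  congr 1
  ring

section

variable (hO : IsGenusZeroModel O) (ht : Irreducible t)
include hO ht

lemma exists_principalPart (n : ℕ) {g : L} (hg : g ∈ O P) :
    ∃ h ∈ poleSpace O P t n, ∃ r ∈ O P, (t : L) ^ n * h = g - (t : L) ^ n * r := by
  have ht0 := coe_ne_zero ht
  obtain ⟨h, hh, hr⟩ := hO.principalPart P (g / (t : L) ^ n)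
  have key : (t : L) ^ n * h = g - (t : L) ^ n * (g / (t : L) ^ n - h) := by
    field_simp; ring
  refine ⟨h, mem_poleSpace.2 ⟨mem_regularAway.2 hh, ?_⟩, _, hr, key⟩
  rw [key]
  exact sub_mem hg (mul_mem (pow_mem t.2 _) hr)

lemma eq_zero_of_functional {ψ : L →ₗ[K] K} (hA : ∀ a ∈ regularAway O P, ψ a = 0)
    (hP : ∀ g ∈ O P, ψ g = 0) : ψ = 0 := by
  ext g
  obtain ⟨h, hh, hr⟩ := hO.principalPart P g
  rw [← sub_add_cancel g h, map_add, hP _ hr, hA _ (mem_regularAway.2 hh), add_zero,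
    LinearMap.zero_apply]

lemma inv_pow_notMem (k : ℕ) {r : L} (hr : r ∈ O P) : (t : L) ^ (k + 1) * r ≠ 1 := by
  intro h
  have h1 := (residue_eq_zero_iff ht (one_mem (O P))).2
    ⟨(t : L) ^ k * r, mul_mem (pow_mem t.2 _) hr, by rw [← h]; ring⟩
  exact one_ne_zero ((map_one (residue (O P))).symm.trans h1)

/-- This is the bound for differentials with a pole of order at most `k + 1` at `P`, the canonical
degree being `-2`. Since `L = A + O P` for the affine ring `A`, such a functional is determined by
its values on `t ^ (k + 1) * V`, where `V` has dimension `(k + 1) deg P + 1`. Two independent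
conditions hold there: it kills `t ^ (k + 1)`, represented by `e = 1`, and it kills `1`, represented
modulo `t ^ (k + 1) O_P` by `a`. -/
lemma finrank_functionals (k : ℕ) : FiniteDimensional K (functionals O P t (k + 1)) ∧
    finrank K (functionals O P t (k + 1)) + 1 ≤ (k + 1) * finrank K (ResidueField (O P)) := by
  obtain ⟨hfin, hrank⟩ := finrank_poleSpace (P := P) ht hO (k + 1)
  have ht0 := coe_ne_zero ht
  let V := poleSpace O P t (k + 1)
  obtain ⟨a, ha, r, hr, hra⟩ := exists_principalPart hO ht (k + 1) (one_mem (O P))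
  let e : V := ⟨1, by
    simpa using algebraMap_mem_poleSpace (O := O) (P := P) (t := t) (1 : K) (k + 1)⟩
  have hli : LinearIndependent K ![e, ⟨a, ha⟩] := by
    rw [LinearIndependent.pair_iff]
    intro c d h
    have h' : c • (1 : L) + d • a = 0 := congrArg Subtype.val h
    have hd : d = 0 := by
      by_contra hd
      have hac : a = algebraMap K L (-c / d) := by
        rw [Algebra.smul_def, Algebra.smul_def, mul_one] at h'
        have : algebraMap K L d ≠ 0 := by simpa using hd
        rw [map_div₀, map_neg]
        field_simp
        linear_combination h'
      refine inv_pow_notMem hO ht k (r := a + r) (add_mem ?_ hr) (by rw [mul_add, hra]; ring)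
      rw [hac]
      exact Subalgebra.algebraMap_mem _ _
    subst hd
    simpa using h'
  let W : Submodule K V := Submodule.span K (Set.range ![e, ⟨a, ha⟩])
  have hW : finrank K W = 2 := by
    simpa using finrank_span_eq_card hli
  have hWd := Subspace.finrank_add_finrank_dualAnnihilator_eq W
  let D : functionals O P t (k + 1) →ₗ[K] W.dualAnnihilator :=
    LinearMap.codRestrict _ ((LinearMap.mulLeft K ((t : L) ^ (k + 1)) ∘ₗ V.subtype).dualMap ∘ₗ
      (functionals O P t (k + 1)).subtype) (by
        intro ψ
        rw [Submodule.mem_dualAnnihilator]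
        intro w hw
        refine Submodule.span_induction (M := V) (p := fun w _ =>
          ψ.1 ((t : L) ^ (k + 1) * (w : L)) = 0) ?_ (by simp) ?_ ?_ hw
        · rintro _ ⟨i, rfl⟩
          fin_cases i
          · exact ψ.2.2 1 (one_mem _)
          · change ψ.1 ((t : L) ^ (k + 1) * a) = 0
            rw [hra, map_sub, ψ.2.1 1 (one_mem _), ψ.2.2 r hr, sub_zero]
        · intro x y _ _ hx hy
          rw [Submodule.coe_add, mul_add, map_add, hx, hy, add_zero]
        · intro c x _ hx
          rw [Submodule.coe_smul, mul_smul_comm, map_smul, hx, smul_zero])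
  have hD : Function.Injective D := by
    rw [injective_iff_map_eq_zero]
    intro ψ hψ
    have h0 : ∀ h ∈ V, ψ.1 ((t : L) ^ (k + 1) * h) = 0 := fun h hh =>
      LinearMap.congr_fun (congrArg Subtype.val hψ) (⟨h, hh⟩ : V)
    refine Subtype.ext (eq_zero_of_functional hO ht ψ.2.1 fun g hg => ?_)
    obtain ⟨h, hh, r, hr, e⟩ := exists_principalPart hO ht (k + 1) hg
    have : g = (t : L) ^ (k + 1) * h + (t : L) ^ (k + 1) * r := by rw [e]; ring
    rw [this, map_add, h0 h hh, ψ.2.2 r hr, add_zero]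
  refine ⟨Module.Finite.of_injective D hD, ?_⟩
  have := LinearMap.finrank_le_finrank_of_injective hD
  change finrank K V = _ at hrank
  omega

omit hO ht in
lemma smul_apply_one_eq_zero {l : Dual K (ResidueField (O P))}
    (hl : l ∈ (Submodule.span K {(1 : ResidueField (O P))}).dualAnnihilator) : l 1 = 0 :=
  (Submodule.mem_dualAnnihilator _).1 hl 1 (Submodule.mem_span_singleton_self _)

/-- The functionals on the residue field that kill `1` form a space of dimension `deg P - 1 ≥ 2`;
two independent ones extend to `L`. Independence is recorded on `O P`, where it can still be read
off. -/
lemma exists_pair_functionals (hm : 3 ≤ finrank K (ResidueField (O P))) :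
    ∃ ψ₁ ∈ functionals O P t 1, ∃ ψ₂ ∈ functionals O P t 1, (∃ g ∈ O P, ψ₁ g ≠ 0) ∧
      ∀ c : K, ∃ g ∈ O P, ψ₂ g ≠ c * ψ₁ g := by
  have := hO.finite P
  let N := (Submodule.span K {(1 : ResidueField (O P))}).dualAnnihilator
  have hN : 2 ≤ finrank K N := by
    have h1 := Subspace.finrank_add_finrank_dualAnnihilator_eq
      (Submodule.span K {(1 : ResidueField (O P))})
    rw [finrank_span_singleton one_ne_zero] at h1
    change 1 + finrank K N = _ at h1
    omega
  have hNb : N ≠ ⊥ := by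
    intro h
    rw [h, finrank_bot] at hN
    omega
  obtain ⟨l₁, hl₁, hl₁0⟩ := Submodule.exists_mem_ne_zero_of_ne_bot hNb
  have hNs : ¬ N ≤ Submodule.span K {l₁} := by
    intro h
    have := Submodule.finrank_mono h
    rw [finrank_span_singleton hl₁0] at this
    omega
  obtain ⟨l₂, hl₂, hl₂s⟩ := SetLike.not_le_iff_exists.1 hNs
  obtain ⟨ψ₁, hA₁, hP₁⟩ := exists_functional hO ht l₁ (smul_apply_one_eq_zero hl₁)
  obtain ⟨ψ₂, hA₂, hP₂⟩ := exists_functional hO ht l₂ (smul_apply_one_eq_zero hl₂)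
  have hmem : ∀ (l : Dual K (ResidueField (O P))) (ψ : L →ₗ[K] K),
      (∀ a ∈ regularAway O P, ψ a = 0) →
      (∀ g, ∀ hg : g ∈ O P, ψ g = l (residue (O P) ⟨g, hg⟩)) → ψ ∈ functionals O P t 1 := by
    intro l ψ hA hP
    refine ⟨hA, fun g hg => ?_⟩
    rw [pow_one, hP _ (mul_mem t.2 hg), (residue_eq_zero_iff ht _).2 ⟨g, hg, rfl⟩, map_zero]
  refine ⟨ψ₁, hmem l₁ ψ₁ hA₁ hP₁, ψ₂, hmem l₂ ψ₂ hA₂ hP₂, ?_, fun c => ?_⟩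
  · by_contra! hcon
    apply hl₁0
    ext x
    obtain ⟨v, rfl⟩ := residue_surjective (R := O P) x
    exact (hP₁ v v.2).symm.trans (hcon v v.2)
  · by_contra! hcon
    refine hl₂s (Submodule.mem_span_singleton.2 ⟨c, ?_⟩)
    ext x
    obtain ⟨v, rfl⟩ := residue_surjective (R := O P) x
    have := hcon v v.2
    rw [hP₁ v v.2, hP₂ v v.2] at this
    exact this.symm

variable (O P) in
omit hO ht in
/-- The functions `a` regular away from `P` such that `a ψ₂` is a multiple of `ψ₁`. -/
def transporter (ψ₁ ψ₂ : L →ₗ[K] K) : Ideal (regularAway O P) where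
  carrier := {a | ∃ b : regularAway O P, ∀ g, ψ₂ (a * g) = ψ₁ (b * g)}
  add_mem' := by
    rintro a a' ⟨b, hb⟩ ⟨b', hb'⟩
    exact ⟨b + b', fun g => by
      push_cast
      rw [add_mul, add_mul, map_add, map_add, hb, hb']⟩
  zero_mem' := ⟨0, by simp⟩
  smul_mem' := by
    rintro c a ⟨b, hb⟩
    refine ⟨c * b, fun g => ?_⟩
    have := hb (c * g)
    rw [smul_eq_mul]
    push_cast
    rw [show (c : L) * a * g = a * (c * g) by ring, this]
    congr 1; ring

/-- Otherwise `ψ₂ = b ψ₁` with `b` regular away from `P`. If `b` is regular at `P`, it is constant,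
against independence. If it has a pole there, `b⁻¹` is a multiple of `t`, so `ψ₁ g = ψ₂ (b⁻¹ g) = 0`
on all of `O P`. -/
lemma transporter_ne_top {ψ₁ ψ₂ : L →ₗ[K] K} (hψ₂ : ψ₂ ∈ functionals O P t 1)
    (h₁ : ∃ g ∈ O P, ψ₁ g ≠ 0) (h₂ : ∀ c : K, ∃ g ∈ O P, ψ₂ g ≠ c * ψ₁ g) :
    transporter O P ψ₁ ψ₂ ≠ ⊤ := by
  rw [Ideal.ne_top_iff_one]
  rintro ⟨b, hb⟩
  simp only [OneMemClass.coe_one, one_mul] at hb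
  by_cases hbP : (b : L) ∈ O P
  · obtain ⟨c, hc⟩ := mem_range_of_mem_of_mem hO b.2 hbP
    obtain ⟨g, -, hg⟩ := h₂ c
    apply hg
    rw [hb, ← hc, ← Algebra.smul_def, map_smul, smul_eq_mul]
  · obtain ⟨h, hh, hbi⟩ := inv_mem_of_notMem ht (hO.isFractionRing P) hbP
    have hb0 : (b : L) ≠ 0 := fun h => hbP (h ▸ zero_mem _)
    obtain ⟨g, hg, hψg⟩ := h₁
    apply hψg
    have h1 := hb ((b : L)⁻¹ * g)
    rw [mul_inv_cancel_left₀ hb0] at h1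
    rw [← h1, hbi, ← hψ₂.2 (h * g) (mul_mem hh hg), pow_one, mul_assoc]

variable (O P t) in
omit hO ht in
/-- The action of functions with poles only at `P` on functionals. -/
def actionMap (k : ℕ) (ψ : functionals O P t 1) :
    poleSpace O P t k →ₗ[K] functionals O P t (k + 1) where
  toFun b := ⟨_, comp_mulLeft_mem_functionals ψ.2 b.2⟩
  map_add' b b' := by ext g; simp [add_mul]
  map_smul' c b := by ext g; simp

/-- A dimension count. If `a₁, …, aₙ` were independent modulo the transporter, with poles of order
at most `k₀`, then `(c, b) ↦ (∑ cᵢ aᵢ) ψ₂ + b ψ₁` would map a space of dimension `n + k₀ deg P + 1`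
to one of dimension at most `(k₀ + 1) deg P - 1`. A nonzero kernel element puts `∑ cᵢ aᵢ` in the
transporter, so `c = 0`, and then `b ψ₁ = 0` forces `b = 0`. -/
lemma rank_quotient_transporter_lt {ψ₁ ψ₂ : L →ₗ[K] K} (hψ₁ : ψ₁ ∈ functionals O P t 1)
    (hψ₂ : ψ₂ ∈ functionals O P t 1) (h₁ : ∃ g ∈ O P, ψ₁ g ≠ 0) {n : ℕ}
    (hn : finrank K (ResidueField (O P)) ≤ n + 1) :
    Module.rank K (regularAway O P ⧸ transporter O P ψ₁ ψ₂) < n := by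
  rw [← not_le, Module.le_rank_iff]
  rintro ⟨v, hv⟩
  choose a ha using fun i => Ideal.Quotient.mk_surjective (v i)
  choose k hk using fun i => exists_mem_poleSpace_of_mem ht hO (a i).2
  let k₀ := Finset.univ.sup k
  have hk₀ : ∀ i, (a i : L) ∈ poleSpace O P t k₀ := fun i =>
    poleSpace_mono (Finset.le_sup (Finset.mem_univ i)) (hk i)
  obtain ⟨hfin, hr⟩ := finrank_poleSpace (P := P) ht hO k₀
  obtain ⟨hfin', hr'⟩ := finrank_functionals hO ht k₀
  let comb : (Fin n → K) →ₗ[K] poleSpace O P t k₀ :=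
    Fintype.linearCombination K fun i => ⟨a i, hk₀ i⟩
  let Φ := (actionMap O P t k₀ ⟨ψ₂, hψ₂⟩ ∘ₗ comb).coprod (actionMap O P t k₀ ⟨ψ₁, hψ₁⟩)
  have hker : Φ.ker ≠ ⊥ := by
    refine LinearMap.ker_ne_bot_of_finrank_lt (K := K) (V := (Fin n → K) × poleSpace O P t k₀)
      (V₂ := functionals O P t (k₀ + 1)) (f := Φ) ?_
    rw [Module.finrank_prod, Module.finrank_fin_fun, hr]
    rw [add_mul, one_mul] at hr'
    omega
  obtain ⟨⟨c, b⟩, hcb, hne⟩ := Submodule.exists_mem_ne_zero_of_ne_bot hker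
  have hrel : ∀ g, ψ₂ (comb c * g) + ψ₁ (b * g) = 0 := fun g =>
    LinearMap.congr_fun (congrArg Subtype.val (LinearMap.mem_ker.1 hcb)) g
  have hmemI : ∑ i, c i • a i ∈ transporter O P ψ₁ ψ₂ := by
    refine ⟨-⟨b, (mem_poleSpace.1 b.2).1⟩, fun g => ?_⟩
    have : ((∑ i, c i • a i : regularAway O P) : L) = comb c := by
      simp [comb, Fintype.linearCombination_apply]
    rw [this, NegMemClass.coe_neg, neg_mul, map_neg]
    exact eq_neg_of_add_eq_zero_left (hrel g)
  have hc : c = 0 := by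
    funext i
    refine Fintype.linearIndependent_iff.1 hv c ?_ i
    rw [← (Ideal.Quotient.eq_zero_iff_mem.2 hmemI), map_sum]
    refine Finset.sum_congr rfl fun i _ => ?_
    rw [← ha i]
    rfl
  obtain ⟨g, -, hg⟩ := h₁
  have hb : b = 0 := by
    by_contra hb0
    have hb0' : (b : L) ≠ 0 := fun h => hb0 (Subtype.ext h)
    apply hg
    have := hrel ((b : L)⁻¹ * g)
    rwa [hc, map_zero, Submodule.coe_zero, zero_mul, map_zero, zero_add,
      mul_inv_cancel_left₀ hb0'] at this
  exact hne (by rw [hc, hb]; rfl)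

lemma not_finite_regularAway : ¬ Module.Finite K (regularAway O P) := by
  intro hf
  obtain ⟨-, hr⟩ := finrank_poleSpace (P := P) ht hO (finrank K (regularAway O P))
  have := hO.finite P
  have hpos : 0 < finrank K (ResidueField (O P)) := finrank_pos
  let j : poleSpace O P t (finrank K (regularAway O P)) →ₗ[K] regularAway O P :=
    LinearMap.codRestrict (Subalgebra.toSubmodule (regularAway O P)) (Submodule.subtype _)
      fun g => (mem_poleSpace.1 g.2).1
  have hj : Function.Injective j := fun x y h => Subtype.ext (congrArg Subtype.val h :)
  have h1 := LinearMap.finrank_le_finrank_of_injective hj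
  have h2 := Nat.le_mul_of_pos_right (finrank K (regularAway O P)) hpos
  omega

/-- The place comes from a maximal ideal above `I`. That ideal is nonzero because its quotient is
finite over `K` and the affine ring is not. -/
lemma exists_place_of_rank_quotient_lt {I : Ideal (regularAway O P)} (hI : I ≠ ⊤) {n : ℕ}
    (hn : Module.rank K (regularAway O P ⧸ I) < n) :
    ∃ q, finrank K (ResidueField (O q)) < n := by
  obtain ⟨M, hM, hIM⟩ := Ideal.exists_le_maximal I hI
  have hf : Function.Surjective (Ideal.Quotient.factorₐ K hIM).toLinearMap :=
    Ideal.Quotient.factor_surjective hIM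
  have hfM := (LinearMap.rank_le_of_surjective _ hf).trans_lt hn
  have hfree : Module.Free K (regularAway O P ⧸ M) := Module.Free.of_divisionRing K _
  have hfin : Module.Finite K (regularAway O P ⧸ M) :=
    (Module.rank_lt_aleph0_iff (R := K) (M := regularAway O P ⧸ M)).1
      (hfM.trans Cardinal.natCast_lt_aleph0)
  have hMb : M ≠ ⊥ := by
    intro h
    rw [h] at hfin
    exact not_finite_regularAway hO ht (Module.Finite.equiv
      (AlgEquiv.quotientBot K (regularAway O P)).toLinearEquiv)
  obtain ⟨q, -, -, ⟨e⟩⟩ := exists_place_of_isMaximal hO ht M hMb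
  refine ⟨q, ?_⟩
  rw [← e.toLinearEquiv.finrank_eq]
  rw [← Module.finrank_eq_rank] at hfM
  exact_mod_cast hfM

/-- If `P` has degree at least `3`, there is a place of degree at most `deg P - 2`. -/
lemma exists_place_of_three_le (hm : 3 ≤ finrank K (ResidueField (O P))) :
    ∃ q, finrank K (ResidueField (O q)) + 1 < finrank K (ResidueField (O P)) := by
  obtain ⟨ψ₁, hψ₁, ψ₂, hψ₂, h₁, h₂⟩ := exists_pair_functionals hO ht hm
  obtain ⟨q, hq⟩ := exists_place_of_rank_quotient_lt hO ht
    (transporter_ne_top hO ht hψ₂ h₁ h₂)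
    (rank_quotient_transporter_lt hO ht hψ₁ hψ₂ h₁
      (n := finrank K (ResidueField (O P)) - 1) (by omega))
  exact ⟨q, by omega⟩

/-- A curve of genus `0` without places of degree `1` has a place of degree `2`. -/
lemma exists_place_finrank_two (h1 : ∀ q, finrank K (ResidueField (O q)) ≠ 1) :
    ∃ q, finrank K (ResidueField (O q)) = 2 := by
  have : ∀ n, ∀ q, finrank K (ResidueField (O q)) = n →
      ∃ q, finrank K (ResidueField (O q)) = 2 := by
    intro n
    induction n using Nat.strong_induction_on with
    | _ n ih =>
      intro q hq
      have := hO.finite q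
      have hpos : 0 < finrank K (ResidueField (O q)) := finrank_pos
      by_cases h2 : n = 2
      · exact ⟨q, hq.trans h2⟩
      · obtain ⟨t', ht'⟩ := IsDiscreteValuationRing.exists_irreducible (O q)
        have := h1 q
        obtain ⟨q', hq'⟩ := exists_place_of_three_le hO ht' (by omega)
        exact ih _ (by omega) q' rfl
  exact this _ P rfl

end

end CurveModel

/-! ### From a place of degree two to the equation of a conic -/

namespace CurveModel

open IsLocalRing Module
open scoped IntermediateField.algebraAdjoinAdjoin

set_option linter.unusedSectionVars false

variable {K L ι : Type*} [Field K] [Field L] [Algebra K L]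

/-- The field `L` is generated over `K` by two functions `x` and `y` that satisfy the equation
`y² = a x² + b` of an affine conic with no rational points at infinity. -/
structure IsConic (a b : K) (x y : L) : Prop where
  sq_eq : y ^ 2 = algebraMap K L a * x ^ 2 + algebraMap K L b
  ne_sq : ∀ c : L, c ^ 2 ≠ algebraMap K L a
  transcendental : Transcendental K x
  adjoin_eq_top : IntermediateField.adjoin K {x, y} = ⊤

variable {O : ι → Subalgebra K L} [∀ p, IsDiscreteValuationRing (O p)] {P : ι} {t : O P}

lemma leadingCoeff_mul {j k : ℕ} (g : poleSpace O P t j) (h : poleSpace O P t k) :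
    leadingCoeff O P t (j + k) ⟨g * h, mul_mem_poleSpace g.2 h.2⟩ =
      leadingCoeff O P t j g * leadingCoeff O P t k h := by
  rw [leadingCoeff_apply, leadingCoeff_apply, leadingCoeff_apply, ← map_mul]
  congr 1
  apply Subtype.ext
  simp only [MulMemClass.coe_mul]
  ring

lemma mem_of_isIntegral {S : Subalgebra K L} [IsDiscreteValuationRing S] (hS : IsFractionRing S L)
    {g : L} (hg : IsIntegral S g) : g ∈ S := by
  obtain ⟨y, hy⟩ := IsIntegrallyClosed.isIntegral_iff.1 hg
  exact hy ▸ y.2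

variable (hO : IsGenusZeroModel O)
include hO

lemma mem_regularAway_of_isIntegral {S : Subalgebra K L} (hS : S ≤ regularAway O P) {g : L}
    (hg : IsIntegral S g) : g ∈ regularAway O P := by
  refine mem_regularAway.2 fun q hq => mem_of_isIntegral (hO.isFractionRing q) ?_
  obtain ⟨p, hp, he⟩ := hg
  refine ⟨p.map (Subalgebra.inclusion (hS.trans (regularAway_le hq))).toRingHom,
    hp.map _, ?_⟩
  rw [Polynomial.eval₂_map]
  exact he

/-- Discrete valuation rings are integrally closed, so an algebraic element is regular at every
place. -/
lemma mem_range_of_isAlgebraic {g : L} (hg : IsAlgebraic K g) : g ∈ (algebraMap K L).range := by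
  refine hO.const g fun p => mem_of_isIntegral (hO.isFractionRing p) ?_
  exact (isAlgebraic_iff_isIntegral.1 hg).tower_top

/-- A nonconstant function generates a subfield over which the function field is algebraic. -/
lemma isAlgebraic_adjoin_simple {x : L} (hx : Transcendental K x) (g : L) :
    IsAlgebraic (Algebra.adjoin K {x}) g := by
  let F := IntermediateField.adjoin K {x}
  have hxF : x ∈ F := IntermediateField.mem_adjoin_simple_self K x
  have hint : g ∈ (integralClosure (Subring.closure (F : Set L)) L).toSubring := by
    -- Integrality over `F = K(x)` is tested on valuation rings containing `F`. A nontrivial one is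
    -- a place, and `F` embeds in its residue field, which is finite over `K`; this contradicts the
    -- transcendence of `x`.
    rw [← iInf_valuationSubring_superset, Subring.mem_iInf]
    rintro ⟨V, hV⟩
    by_contra hgV
    obtain ⟨p, hp⟩ := hO.proper V (fun c => hV (F.algebraMap_mem c)) (by
      rintro rfl
      exact hgV trivial)
    have hF : F.toSubalgebra ≤ O p := fun f hf => (hp f).1 (hV hf)
    let φ : F →ₐ[K] ResidueField (O p) :=
      (IsScalarTower.toAlgHom K (O p) (ResidueField (O p))).comp
        (Subalgebra.inclusion hF : F.toSubalgebra →ₐ[K] O p)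
    have := hO.finite p
    have h1 : IsAlgebraic K (φ ⟨x, hxF⟩) := Algebra.IsAlgebraic.isAlgebraic _
    rw [isAlgebraic_algHom_iff φ φ.toRingHom.injective] at h1
    exact hx (h1.algHom F.val)
  have hcl : Subring.closure (F : Set L) ≤ F.toSubfield.toSubring := Subring.closure_le.2 le_rfl
  have hgF : IsIntegral F g := by
    obtain ⟨p, hp, he⟩ : IsIntegral (Subring.closure (F : Set L)) g := hint
    refine ⟨p.map ((Subring.subtype _).codRestrict F fun y => hcl y.2), hp.map _, ?_⟩
    rw [Polynomial.eval₂_map]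
    exact he
  rw [IsFractionRing.isAlgebraic_iff (Algebra.adjoin K {x}) (IntermediateField.adjoin K {x}) L]
  exact hgF.isAlgebraic

lemma exists_mul_mem_regularAway {x : L} (hxA : x ∈ regularAway O P) (hx : Transcendental K x)
    (g : L) : ∃ d ∈ regularAway O P, d ≠ 0 ∧ d * g ∈ regularAway O P := by
  obtain ⟨d, hd, hint⟩ := (isAlgebraic_adjoin_simple hO hx g).exists_integral_multiple
  have hle : Algebra.adjoin K {x} ≤ regularAway O P := Algebra.adjoin_le (by simpa using hxA)
  exact ⟨d, hle d.2, fun h => hd (Subtype.ext h), mem_regularAway_of_isIntegral hO hle hint⟩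

variable (ht : Irreducible t)
include ht

lemma notMem_of_leadingCoeff_ne_zero {x : poleSpace O P t 1} (hx : leadingCoeff O P t 1 x ≠ 0) :
    (x : L) ∉ O P := by
  intro h
  apply hx
  exact (leadingCoeff_succ_eq_zero_iff ht (k := 0) x).2
    (mem_poleSpace.2 ⟨(mem_poleSpace.1 x.2).1, by simpa using h⟩)

lemma transcendental_of_notMem {x : L} (hx : x ∉ O P) : Transcendental K x := by
  intro h
  obtain ⟨c, rfl⟩ := mem_range_of_isAlgebraic hO h
  exact hx ((O P).algebraMap_mem c)


lemma sq_ne_of_ne {s : ResidueField (O P)} {a : K} (hs : s ∉ (algebraMap K _).range)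
    (hsa : s ^ 2 = algebraMap K _ a) (c : L) : c ^ 2 ≠ algebraMap K L a := by
  intro hc
  obtain ⟨d, rfl⟩ := mem_range_of_isAlgebraic hO (g := c)
    ⟨Polynomial.X ^ 2 - Polynomial.C a, Polynomial.X_pow_sub_C_ne_zero two_pos a, by simp [hc]⟩
  rw [← map_pow] at hc
  have h1 : d ^ 2 = a := (algebraMap K L).injective hc
  rw [← h1, map_pow, sq_eq_sq_iff_eq_or_eq_neg] at hsa
  rcases hsa with h | h
  · exact hs ⟨d, h.symm⟩
  · exact hs ⟨-d, by rw [map_neg, h]⟩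

omit hO ht in
lemma exists_eq_add_mul {s : ResidueField (O P)} (h2 : finrank K (ResidueField (O P)) = 2)
    (hs : s ∉ (algebraMap K _).range) (c : ResidueField (O P)) :
    ∃ α β : K, c = algebraMap K _ α + algebraMap K _ β * s := by
  have hli : LinearIndependent K ![1, s] := by
    rw [LinearIndependent.pair_iff' one_ne_zero]
    intro a ha
    exact hs ⟨a, by rw [← ha, Algebra.algebraMap_eq_smul_one]⟩
  have htop := hli.span_eq_top_of_card_eq_finrank (by simp [h2])
  have hc : c ∈ Submodule.span K (Set.range ![1, s]) := htop ▸ Submodule.mem_top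
  rw [Matrix.range_cons, Matrix.range_cons, Matrix.range_empty, Set.union_empty,
    Set.singleton_union, Submodule.mem_span_pair] at hc
  obtain ⟨α, β, h⟩ := hc
  exact ⟨α, β, by rw [← h, Algebra.smul_def, Algebra.smul_def, mul_one]⟩

/-- The functions with at most a simple pole at a place of degree `2`. -/
lemma mem_poleSpace_succ_cases {s : ResidueField (O P)} {x y : poleSpace O P t 1}
    (h2 : finrank K (ResidueField (O P)) = 2) (hs : s ∉ (algebraMap K _).range)
    (hx : leadingCoeff O P t 1 x = 1) (hy : leadingCoeff O P t 1 y = s) (k : ℕ) {g : L}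
    (hg : g ∈ poleSpace O P t (k + 1)) : ∃ α β : K,
      g - (algebraMap K L α * (x : L) ^ (k + 1) + algebraMap K L β * ((x : L) ^ k * y)) ∈
        poleSpace O P t k := by
  have hpow : ∀ k, ∃ h : (x : L) ^ k ∈ poleSpace O P t k,
      leadingCoeff O P t k ⟨(x : L) ^ k, h⟩ = 1 := by
    intro k
    induction k with
    | zero =>
      refine ⟨by simpa using algebraMap_mem_poleSpace (O := O) (P := P) (t := t) (1 : K) 0, ?_⟩
      rw [leadingCoeff_apply]
      simp only [pow_zero, mul_one]
      exact map_one _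
    | succ k ih =>
      obtain ⟨h, h1⟩ := ih
      refine ⟨by rw [pow_succ]; exact mul_mem_poleSpace h x.2, ?_⟩
      have := leadingCoeff_mul ⟨_, h⟩ x
      rw [h1, hx, one_mul] at this
      rw [← this]
      congr 1
      exact Subtype.ext (pow_succ _ _)
  obtain ⟨α, β, h⟩ := exists_eq_add_mul h2 hs (leadingCoeff O P t (k + 1) ⟨g, hg⟩)
  obtain ⟨h1, h1'⟩ := hpow (k + 1)
  obtain ⟨h0, h0'⟩ := hpow k
  refine ⟨α, β, ?_⟩
  have := leadingCoeff_mul ⟨_, h0⟩ y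
  rw [h0', hy, one_mul] at this
  have key := (leadingCoeff_succ_eq_zero_iff ht (⟨g, hg⟩ - (α • ⟨_, h1⟩ +
    β • ⟨_, mul_mem_poleSpace h0 y.2⟩))).1 (by
      rw [map_sub, map_add, map_smul, map_smul, h1', this, h, Algebra.smul_def, Algebra.smul_def]
      ring)
  simpa [Algebra.smul_def] using key

/-- The leading coefficients of `x ^ (k + 1)` and `x ^ k * y` are `1` and `s`, a `K`-basis of the
residue field. Subtracting a combination of them lowers the pole order, until only a constant
remains. -/
lemma regularAway_eq_adjoin {s : ResidueField (O P)} {x y : poleSpace O P t 1}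
    (h2 : finrank K (ResidueField (O P)) = 2) (hs : s ∉ (algebraMap K _).range)
    (hx : leadingCoeff O P t 1 x = 1) (hy : leadingCoeff O P t 1 y = s) :
    regularAway O P = Algebra.adjoin K {(x : L), (y : L)} := by
  have hxm : (x : L) ∈ Algebra.adjoin K {(x : L), (y : L)} := Algebra.subset_adjoin (by simp)
  have hym : (y : L) ∈ Algebra.adjoin K {(x : L), (y : L)} := Algebra.subset_adjoin (by simp)
  apply le_antisymm
  · intro g hg
    obtain ⟨k, hk⟩ := exists_mem_poleSpace_of_mem ht hO hg
    clear hg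
    induction k generalizing g with
    | zero =>
      obtain ⟨c, rfl⟩ := (mem_poleSpace_zero_iff hO).1 hk
      exact Subalgebra.algebraMap_mem _ c
    | succ k ih =>
      obtain ⟨α, β, h⟩ := mem_poleSpace_succ_cases hO ht h2 hs hx hy k hk
      rw [← sub_add_cancel g (_ + _)]
      exact add_mem (ih h) (add_mem (mul_mem (Subalgebra.algebraMap_mem _ _) (pow_mem hxm _))
        (mul_mem (Subalgebra.algebraMap_mem _ _) (mul_mem (pow_mem hxm _) hym)))
  · rw [Algebra.adjoin_le_iff]
    rintro _ (rfl | rfl)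
    · exact (mem_poleSpace.1 x.2).1
    · exact (mem_poleSpace.1 y.2).1

/-- The leading coefficient of `y² - a x²` at order 2 is `s² - a = 0`. So `y² - a x²` has at most a
simple pole and equals `α x + β y + γ`; completing both squares removes the linear terms. -/
lemma exists_conic_generators (hc : (2 : K) ≠ 0) {s : ResidueField (O P)} {a : K}
    (h2 : finrank K (ResidueField (O P)) = 2) (hs : s ∉ (algebraMap K _).range)
    (hsa : s ^ 2 = algebraMap K _ a) :
    ∃ (b : K) (x y : poleSpace O P t 1), leadingCoeff O P t 1 x = 1 ∧ leadingCoeff O P t 1 y = s ∧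
      (y : L) ^ 2 = algebraMap K L a * (x : L) ^ 2 + algebraMap K L b := by
  obtain ⟨x, hx⟩ : ∃ x : poleSpace O P t 1, leadingCoeff O P t 1 x = 1 :=
    leadingCoeff_surjective ht hO 0 1
  obtain ⟨y, hy⟩ : ∃ y : poleSpace O P t 1, leadingCoeff O P t 1 y = s :=
    leadingCoeff_surjective ht hO 0 s
  have ha : a ≠ 0 := by
    rintro rfl
    rw [map_zero, sq_eq_zero_iff] at hsa
    exact hs (hsa ▸ zero_mem _)
  have hmem : (y : L) ^ 2 - algebraMap K L a * (x : L) ^ 2 ∈ poleSpace O P t 1 := by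
    have h1 := leadingCoeff_mul y y
    have h2 := leadingCoeff_mul x x
    rw [hy] at h1
    rw [hx, mul_one] at h2
    have := (leadingCoeff_succ_eq_zero_iff ht (k := 1) (⟨_, mul_mem_poleSpace y.2 y.2⟩ -
      a • ⟨_, mul_mem_poleSpace x.2 x.2⟩)).1 (by
        rw [map_sub, map_smul]
        rw [Algebra.smul_def]
        linear_combination h1 - algebraMap K _ a * h2 + hsa)
    simpa [Algebra.smul_def, pow_two] using this
  obtain ⟨α, β, h⟩ := mem_poleSpace_succ_cases hO ht h2 hs hx hy 0 hmem
  obtain ⟨γ, hγ⟩ := (mem_poleSpace_zero_iff hO).1 h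
  have hconst : ∀ c : K, leadingCoeff O P t 1 ⟨_, algebraMap_mem_poleSpace c 1⟩ = 0 := fun c =>
    (leadingCoeff_succ_eq_zero_iff ht (k := 0) _).2 (algebraMap_mem_poleSpace c 0)
  refine ⟨γ + β ^ 2 / 4 - α ^ 2 / (4 * a), x + ⟨_, algebraMap_mem_poleSpace (α / (2 * a)) 1⟩,
    y - ⟨_, algebraMap_mem_poleSpace (β / 2) 1⟩, ?_, ?_, ?_⟩
  · rw [map_add, hconst, add_zero]; exact hx
  · rw [map_sub, hconst, sub_zero]; exact hy
  · have ha' : algebraMap K L a ≠ 0 := by simpa using ha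
    have hc' : (2 : L) ≠ 0 := by
      have := (map_ne_zero (algebraMap K L)).2 hc
      rwa [map_ofNat] at this
    have hc4 : (4 : L) ≠ 0 := by
      rw [show (4 : L) = 2 * 2 by norm_num]; exact mul_ne_zero hc' hc'
    simp only [Submodule.coe_add, Submodule.coe_sub, map_add, map_sub, map_div₀, map_mul, map_pow,
      map_ofNat]
    rw [pow_zero, zero_add, pow_one, one_mul] at hγ
    have hγ' : (y : L) ^ 2 = algebraMap K L a * (x : L) ^ 2 + algebraMap K L γ +
        algebraMap K L α * x + algebraMap K L β * y := by
      rw [hγ]; ring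
    field_simp
    linear_combination (16 * algebraMap K L a) * hγ'

/-- A curve of genus `0` with a place of degree `2` is a conic, which has a point of degree `1`
if its equation has a solution. -/
theorem exists_isConic (hc : (2 : K) ≠ 0) {s : ResidueField (O P)} {a : K}
    (h2 : finrank K (ResidueField (O P)) = 2) (hs : s ∉ (algebraMap K _).range)
    (hsa : s ^ 2 = algebraMap K _ a) :
    ∃ (b : K) (x y : L), IsConic a b x y ∧ ((∃ x₀ y₀ : K, y₀ ^ 2 = a * x₀ ^ 2 + b) →
      ∃ q, finrank K (ResidueField (O q)) = 1) := by
  obtain ⟨b, x, y, hx, hy, hxy⟩ := exists_conic_generators hO ht hc h2 hs hsa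
  have hA := regularAway_eq_adjoin hO ht h2 hs hx hy
  have hxP := notMem_of_leadingCoeff_ne_zero hO ht (x := x) (by rw [hx]; exact one_ne_zero)
  have htr := transcendental_of_notMem hO ht hxP
  refine ⟨b, x, y, ⟨hxy, sq_ne_of_ne hO ht hs hsa, htr, ?_⟩, ?_⟩
  · rw [eq_top_iff]
    intro g _
    obtain ⟨d, hd, hd0, hdg⟩ := exists_mul_mem_regularAway hO (mem_poleSpace.1 x.2).1 htr g
    have hle : regularAway O P ≤
        (IntermediateField.adjoin K {(x : L), (y : L)}).toSubalgebra := by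
      rw [hA]; exact IntermediateField.algebra_adjoin_le_adjoin K _
    rw [← mul_div_cancel_left₀ g hd0]
    exact div_mem (hle hdg) (hle hd)
  · rintro ⟨x₀, y₀, h₀⟩
    -- A solution `(x₀, y₀)` gives a place on the line `x = x₀`. The function `u = x - x₀` is not a
    -- unit, since its inverse would vanish at `P` and hence be a constant. At a place where `u`
    -- vanishes, `x` takes the value `x₀` and `y` one of `± y₀`, so the residue field is `K`.
    let u : regularAway O P := ⟨x, (mem_poleSpace.1 x.2).1⟩ - algebraMap K _ x₀
    let v : regularAway O P := ⟨y, (mem_poleSpace.1 y.2).1⟩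
    have huP : (u : L) ∉ O P := fun h => hxP (by
      have := add_mem h ((O P).algebraMap_mem x₀)
      simpa [u] using this)
    have hu0 : u ≠ 0 := fun h => huP (by rw [h]; exact zero_mem _)
    have hI : Ideal.span {u} ≠ ⊤ := by
      rw [Ne, Ideal.span_singleton_eq_top]
      intro hu
      obtain ⟨w, hw⟩ := hu.exists_right_inv
      have hw1 : (u : L) * w = 1 := congrArg Subtype.val hw
      obtain ⟨h, hh, e⟩ := inv_mem_of_notMem ht (hO.isFractionRing P) huP
      have hwP : (w : L) ∈ O P := by
        rw [← inv_eq_of_mul_eq_one_right hw1, e]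
        exact mul_mem t.2 hh
      obtain ⟨c, hc⟩ := mem_range_of_mem_of_mem hO w.2 hwP
      apply huP
      rw [← inv_eq_of_mul_eq_one_left hw1, ← hc, ← map_inv₀]
      exact (O P).algebraMap_mem _
    obtain ⟨M, hM, hIM⟩ := Ideal.exists_le_maximal _ hI
    have huM : u ∈ M := hIM (Ideal.mem_span_singleton_self u)
    have hMb : M ≠ ⊥ := by
      rintro rfl
      exact hu0 (Ideal.mem_bot.1 huM)
    obtain ⟨q, hq, hker, ⟨e⟩⟩ := exists_place_of_isMaximal hO ht M hMb
    refine ⟨q, ?_⟩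
    have hsurj : Function.Surjective (evalAt (O := O) hq) :=
      evalAt_surjective hO hq hu0 (by rw [← RingHom.mem_ker, hker]; exact huM)
    have hxq : evalAt (O := O) hq ⟨x, (mem_poleSpace.1 x.2).1⟩ = algebraMap K _ x₀ := by
      have : evalAt (O := O) hq u = 0 := by rw [← RingHom.mem_ker, hker]; exact huM
      rw [map_sub, AlgHom.commutes] at this
      exact sub_eq_zero.1 this
    have hyq : evalAt (O := O) hq v ∈ (⊥ : Subalgebra K (ResidueField (O q))) := by
      have hv : v ^ 2 = algebraMap K _ a * ⟨x, (mem_poleSpace.1 x.2).1⟩ ^ 2 + algebraMap K _ b :=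
        Subtype.ext hxy
      have h1 := congrArg (evalAt (O := O) hq) hv
      have h2 := congrArg (algebraMap K (ResidueField (O q))) h₀
      simp only [map_pow, map_add, map_mul, AlgHom.commutes, hxq] at h1 h2
      have := h1.trans h2.symm
      rw [sq_eq_sq_iff_eq_or_eq_neg] at this
      rcases this with h | h
      · rw [h]; exact Subalgebra.algebraMap_mem _ _
      · rw [h]; exact neg_mem (Subalgebra.algebraMap_mem _ _)
    have hle : regularAway O P ≤ ((⊥ : Subalgebra K (ResidueField (O q))).comap
        (evalAt (O := O) hq)).map (regularAway O P).val := by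
      conv_lhs => rw [hA]
      rw [Algebra.adjoin_le_iff]
      rintro _ (rfl | rfl)
      · exact ⟨⟨x, (mem_poleSpace.1 x.2).1⟩, by
          change evalAt (O := O) hq _ ∈ (⊥ : Subalgebra K _)
          rw [hxq]; exact Subalgebra.algebraMap_mem _ _, rfl⟩
      · exact ⟨v, hyq, rfl⟩
    apply Subalgebra.bot_eq_top_iff_finrank_eq_one.1
    rw [eq_top_iff]
    intro c _
    obtain ⟨g, rfl⟩ := hsurj c
    obtain ⟨g', hg', hgg⟩ := hle g.2
    obtain rfl : g' = g := Subtype.ext hgg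
    exact hg'

end CurveModel

/-! ### Splitting a conic over a quadratic extension -/

namespace CurveModel

open Module Polynomial IntermediateField

set_option linter.unusedSectionVars false

section Sqrt

variable {K M : Type*} [Field K] [Field M] [Algebra K M]

lemma finrank_adjoin_sqrt {s : M} {a : K} (hs : s ^ 2 = algebraMap K M a)
    (ha : ∀ c : K, c ^ 2 ≠ a) : finrank K K⟮s⟯ = 2 := by
  have hs' : aeval s (X ^ 2 - C a) = 0 := by simp [hs]
  have hint : IsIntegral K s := ⟨X ^ 2 - C a, monic_X_pow_sub_C a two_ne_zero, hs'⟩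
  have hirr : Irreducible (X ^ 2 - C a) :=
    X_pow_sub_C_irreducible_of_prime Nat.prime_two ha
  rw [adjoin.finrank hint, ← minpoly.eq_of_irreducible_of_monic hirr hs'
    (monic_X_pow_sub_C a two_ne_zero), natDegree_X_pow_sub_C]

lemma mem_adjoin_sqrt {s : M} {a : K} (hs : s ^ 2 = algebraMap K M a) {e : M} (he : e ∈ K⟮s⟯) :
    ∃ y₀ x₀ : K, e = algebraMap K M y₀ - s * algebraMap K M x₀ := by
  have hint : IsIntegral K s := ⟨X ^ 2 - C a, monic_X_pow_sub_C a two_ne_zero, by simp [hs]⟩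
  rw [← mem_toSubalgebra, adjoin_simple_toSubalgebra_of_isAlgebraic hint.isAlgebraic] at he
  induction he using Algebra.adjoin_induction with
  | mem x hx =>
    obtain rfl : x = s := hx
    exact ⟨0, -1, by simp⟩
  | algebraMap r => exact ⟨r, 0, by simp⟩
  | add x y _ _ hx hy =>
    obtain ⟨p, q, rfl⟩ := hx
    obtain ⟨p', q', rfl⟩ := hy
    exact ⟨p + p', q + q', by simp only [map_add]; ring⟩
  | mul x y _ _ hx hy =>
    obtain ⟨p, q, rfl⟩ := hx
    obtain ⟨p', q', rfl⟩ := hy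
    refine ⟨p * p' + a * (q * q'), p * q' + q * p', ?_⟩
    simp only [map_add, map_mul, ← hs]
    ring

/-- Allows one subfield of `M` to be presented both as `L'(√a)` and as `K(√a)(w)`. -/
lemma finrank_eq_of_toSubfield_eq {F G : Type*} [Field F] [Field G] [Algebra F M] [Algebra G M]
    {A : IntermediateField F M} {B : IntermediateField G M} (h : A.toSubfield = B.toSubfield) :
    finrank A M = finrank B M := by
  change finrank A.toSubfield M = finrank B.toSubfield M
  rw [h]

/-- If `z` generates `M` over `F`, the degree of `M` over `F(p(z) / q(z))` is the degree of the
rational function `p / q`. -/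
lemma exists_finrank_adjoin_eq {z : M} (hz : Transcendental K z) (hM : K⟮z⟯ = ⊤) (w : M) :
    ∃ p q : K[X], IsCoprime p q ∧ q ≠ 0 ∧ aeval z p = w * aeval z q ∧
      finrank K⟮w⟯ M = max p.natDegree q.natDegree := by
  let e : RatFunc K ≃ₐ[K] M :=
    (RatFunc.algEquivOfTranscendental z hz).trans ((equivOfEq hM).trans topEquiv)
  obtain ⟨r, rfl⟩ := e.surjective w
  have he : ∀ f, e (algebraMap K[X] _ f) = aeval z f := fun f => by
    simp only [e, AlgEquiv.trans_apply, RatFunc.algEquivOfTranscendental_algebraMap]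
    change ((aeval (AdjoinSimple.gen K z) f : K⟮z⟯) : M) = _
    rw [← IntermediateField.algebraMap_apply, ← aeval_algebraMap_apply]
    rfl
  refine ⟨r.num, r.denom, r.isCoprime_num_denom, r.denom_ne_zero, ?_, ?_⟩
  · rw [← he, ← he, ← map_mul]
    congr 1
    nth_rw 2 [← RatFunc.num_div_denom r]
    rw [div_mul_cancel₀ _ (RatFunc.algebraMap_ne_zero r.denom_ne_zero)]
  · rw [← RatFunc.finrank_eq_max_natDegree]
    have hmap : K⟮r⟯.map (e : RatFunc K →ₐ[K] M) = K⟮e r⟯ := by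
      rw [adjoin_map]; simp
    let e₁ : K⟮r⟯ ≃ₐ[K] K⟮e r⟯ := (K⟮r⟯.equivMap (e : RatFunc K →ₐ[K] M)).trans (equivOfEq hmap)
    refine (Algebra.finrank_eq_of_equiv_equiv e₁.toRingEquiv e.toRingEquiv ?_).symm
    ext f
    rfl

end Sqrt

section Conic

variable {K L M : Type*} [Field K] [Field L] [Algebra K L] [Field M] [Algebra K M] [Algebra L M]
  [IsScalarTower K L M] {a b : K} {x y : L}

lemma IsConic.ne_zero (h : IsConic a b x y) : b ≠ 0 := by
  rintro rfl
  have hx : x ≠ 0 := by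
    rintro rfl
    exact h.transcendental isAlgebraic_zero
  apply h.ne_sq (y / x)
  have := h.sq_eq
  rw [map_zero, add_zero] at this
  field_simp
  linear_combination this

lemma IsConic.ne_sq_base (h : IsConic a b x y) (c : K) : c ^ 2 ≠ a := fun hc =>
  h.ne_sq (algebraMap K L c) (by rw [← map_pow, hc])

lemma IsConic.sqrt_ne_zero (h : IsConic a b x y) {s : M} (hs : s ^ 2 = algebraMap K M a) :
    s ≠ 0 := by
  rintro rfl
  apply h.ne_sq_base 0
  apply (algebraMap K M).injective
  rw [← hs]; simp

lemma IsConic.mul_eq (h : IsConic a b x y) {s : M} (hs : s ^ 2 = algebraMap K M a) :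
    (algebraMap L M y - s * algebraMap L M x) * (algebraMap L M y + s * algebraMap L M x) =
      algebraMap K M b := by
  have := congrArg (algebraMap L M) h.sq_eq
  simp only [map_add, map_mul, map_pow, ← IsScalarTower.algebraMap_apply] at this
  linear_combination this - (algebraMap L M x) ^ 2 * hs

/-- After adjoining `√a`, the conic becomes a projective line with parameter `y - √a x`. -/
lemma IsConic.adjoin_sqrt_eq (h : IsConic a b x y) (h2 : (2 : K) ≠ 0) {s : M}
    (hs : s ^ 2 = algebraMap K M a) :
    L⟮s⟯.toSubfield = K⟮s⟯⟮algebraMap L M y - s * algebraMap L M x⟯.toSubfield := by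
  set z := algebraMap L M y - s * algebraMap L M x with hz
  have h2M : (2 : M) ≠ 0 := by
    have := (map_ne_zero (algebraMap K M)).2 h2
    rwa [map_ofNat] at this
  have hs0 := h.sqrt_ne_zero hs
  have hzN : K⟮s⟯⟮z⟯.toSubfield = (K⟮s⟯⟮z⟯.restrictScalars K).toSubfield := rfl
  apply le_antisymm
  · set N := K⟮s⟯⟮z⟯.restrictScalars K
    have hsN : s ∈ N := K⟮s⟯⟮z⟯.algebraMap_mem ⟨s, mem_adjoin_simple_self K s⟩
    have hzN : z ∈ N := mem_adjoin_simple_self K⟮s⟯ z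
    have hm := h.mul_eq hs
    have hb : algebraMap K M b ≠ 0 := by simpa using h.ne_zero
    have hz0 : z ≠ 0 := left_ne_zero_of_mul (hm.trans_ne hb)
    -- The conjugate factor is `b / z`; half the sum and half the difference of the two factors
    -- recover `y` and `√a x`.
    have hz' : algebraMap L M y + s * algebraMap L M x ∈ N := by
      rw [show algebraMap L M y + s * algebraMap L M x = algebraMap K M b / z by
        rw [eq_div_iff hz0, ← hm]; ring]
      exact div_mem (N.algebraMap_mem b) hzN
    have h2N : (2 : M) ∈ N := by
      have := N.algebraMap_mem 2
      rwa [map_ofNat] at this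
    have hyN : algebraMap L M y ∈ N := by
      rw [show algebraMap L M y = (z + (algebraMap L M y + s * algebraMap L M x)) / 2 by
        rw [hz]; field_simp; ring]
      exact div_mem (add_mem hzN hz') h2N
    have hxN : algebraMap L M x ∈ N := by
      rw [show algebraMap L M x = ((algebraMap L M y + s * algebraMap L M x) - z) / (2 * s) by
        rw [hz]; field_simp; ring]
      exact div_mem (sub_mem hz' hzN) (mul_mem h2N hsN)
    have hLN : ∀ c : L, algebraMap L M c ∈ N := by
      have : (⊤ : IntermediateField K L) ≤ N.comap (IsScalarTower.toAlgHom K L M) := by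
        rw [← h.adjoin_eq_top, adjoin_le_iff]
        rintro _ (rfl | rfl)
        · exact hxN
        · exact hyN
      exact fun c => this (mem_top (x := c))
    change L⟮s⟯.toSubfield ≤ N.toSubfield
    rw [adjoin_toSubfield, Subfield.closure_le]
    rintro _ (⟨c, rfl⟩ | rfl)
    · exact hLN c
    · exact hsN
  · have h1 : K⟮s⟯ ≤ L⟮s⟯.restrictScalars K := by
      rw [adjoin_simple_le_iff]
      exact mem_adjoin_simple_self L s
    rw [adjoin_toSubfield, Subfield.closure_le]
    rintro _ (⟨c, rfl⟩ | rfl)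
    · exact h1 c.2
    · exact sub_mem (L⟮s⟯.algebraMap_mem y)
        (mul_mem (mem_adjoin_simple_self L s) (L⟮s⟯.algebraMap_mem x))

/-- If `z` were algebraic, so would be `b / z`, and therefore `x = (b / z - z) / (2 s)`. -/
lemma IsConic.transcendental_sub (h : IsConic a b x y) (h2 : (2 : K) ≠ 0) {s : M}
    (hs : s ^ 2 = algebraMap K M a) :
    Transcendental K⟮s⟯ (algebraMap L M y - s * algebraMap L M x) := by
  intro hz
  have hsalg : IsAlgebraic K s :=
    ⟨X ^ 2 - C a, X_pow_sub_C_ne_zero two_pos a, by simp [hs]⟩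
  have : Algebra.IsAlgebraic K K⟮s⟯ := IntermediateField.isAlgebraic_adjoin_simple hsalg.isIntegral
  replace hz : IsAlgebraic K (algebraMap L M y - s * algebraMap L M x) :=
    hz.restrictScalars K
  have hm := h.mul_eq hs
  have hb : algebraMap K M b ≠ 0 := by simpa using h.ne_zero
  have hz0 := left_ne_zero_of_mul (hm.trans_ne hb)
  have hz' : IsAlgebraic K (algebraMap L M y + s * algebraMap L M x) := by
    rw [show algebraMap L M y + s * algebraMap L M x = algebraMap K M b * 
      (algebraMap L M y - s * algebraMap L M x)⁻¹ by rw [← hm]; field_simp]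
    exact (isAlgebraic_algebraMap b).mul hz.inv
  have h2M : (2 : M) ≠ 0 := by
    have := (map_ne_zero (algebraMap K M)).2 h2
    rwa [map_ofNat] at this
  have hx : IsAlgebraic K (algebraMap L M x) := by
    have hs0 := h.sqrt_ne_zero hs
    rw [show algebraMap L M x = ((algebraMap L M y + s * algebraMap L M x) -
      (algebraMap L M y - s * algebraMap L M x)) * (algebraMap K M 2 * s)⁻¹ by
        rw [map_ofNat]; field_simp; ring]
    exact (hz'.sub hz).mul ((isAlgebraic_algebraMap 2).mul hsalg).inv
  exact h.transcendental ((isAlgebraic_algebraMap_iff (algebraMap L M).injective).1 hx)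

end Conic

end CurveModel

/-! ### The norm relation, and isomorphisms between conics -/

namespace CurveModel

open Module Polynomial IntermediateField

section Norm

variable {F M : Type*} [Field F] [Field M] [Algebra F M]

/-- Since `σ(z) = b / z`, clearing denominators in `σ(f(z))` gives a twisted reciprocal polynomial:
the term `c zⁱ` becomes `σ(c) bⁱ z ^ (d - i)`. -/
lemma exists_aeval_eq_pow_mul (σ : M →+* M)
    (hσ : ∀ c : F, ∃ c' : F, σ (algebraMap F M c) = algebraMap F M c') {z : M} {b : F}
    (hz : z * σ z = algebraMap F M b) {d : ℕ} {f : F[X]} (hf : f.natDegree ≤ d) :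
    ∃ g : F[X], g.natDegree ≤ d ∧ aeval z g = z ^ d * σ (aeval z f) := by
  choose τ hτ using hσ
  refine ⟨∑ i ∈ Finset.range (d + 1), C (τ (f.coeff i) * b ^ i) * X ^ (d - i), ?_, ?_⟩
  · refine natDegree_sum_le_of_forall_le _ _ fun i _ => ?_
    exact (natDegree_C_mul_X_pow_le _ _).trans (Nat.sub_le d i)
  · nth_rw 2 [f.as_sum_range_C_mul_X_pow' (Nat.lt_succ_of_le hf)]
    simp only [map_sum, map_mul, map_pow, aeval_C, aeval_X, Finset.mul_sum, hτ, ← hz]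
    refine Finset.sum_congr rfl fun i hi => ?_
    rw [← Nat.sub_add_cancel (Nat.lt_succ_iff.1 (Finset.mem_range.1 hi)), pow_add,
      Nat.sub_add_cancel (Nat.lt_succ_iff.1 (Finset.mem_range.1 hi))]
    ring

/-- If `σ` maps `z` to `b / z` and `p(z) / q(z)` to `b' / (p(z) / q(z))`, then `b'` is a norm
times a power of `b`. -/
lemma exists_mul_pow_eq_norm (σ : M →+* M)
    (hσ : ∀ c : F, ∃ c' : F, σ (algebraMap F M c) = algebraMap F M c') (hσσ : ∀ m, σ (σ m) = m)
    {z w : M} (htr : Transcendental F z) {b b' : F}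
    (hz : z * σ z = algebraMap F M b) (hw : w * σ w = algebraMap F M b') (hb0 : b ≠ 0)
    (hb' : b' ≠ 0) {p q : F[X]} (hpq : IsCoprime p q) (hq : q ≠ 0)
    (h : aeval z p = w * aeval z q) :
    ∃ e : F, algebraMap F M e * σ (algebraMap F M e) =
      algebraMap F M (b' * b ^ max p.natDegree q.natDegree) := by
  set d := max p.natDegree q.natDegree with hd
  have hinj : Function.Injective (aeval z : F[X] →ₐ[F] M) :=
    transcendental_iff_injective.1 htr
  have h0 : ∀ {f : F[X]}, f ≠ 0 → aeval z f ≠ 0 := fun hf h' => hf (hinj (by rw [h', map_zero]))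
  have hbM : algebraMap F M b ≠ 0 := by simpa using hb0
  have hbM' : algebraMap F M b' ≠ 0 := by simpa using hb'
  have hz0 : z ≠ 0 := left_ne_zero_of_mul (hz.trans_ne hbM)
  have hw0 : w ≠ 0 := left_ne_zero_of_mul (hw.trans_ne hbM')
  have hp : p ≠ 0 := by
    rintro rfl
    rw [map_zero] at h
    exact mul_ne_zero hw0 (h0 hq) h.symm
  obtain ⟨p', hp'd, hp'⟩ := exists_aeval_eq_pow_mul σ hσ hz (le_max_left _ _ : p.natDegree ≤ d)
  obtain ⟨q', hq'd, hq'⟩ := exists_aeval_eq_pow_mul σ hσ hz (le_max_right _ _ : q.natDegree ≤ d)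
  have hp'0 : p' ≠ 0 := by
    rintro rfl
    rw [map_zero] at hp'
    exact mul_ne_zero (pow_ne_zero _ hz0) ((map_ne_zero σ).2 (h0 hp)) hp'.symm
  have hq'0 : q' ≠ 0 := by
    rintro rfl
    rw [map_zero] at hq'
    exact mul_ne_zero (pow_ne_zero _ hz0) ((map_ne_zero σ).2 (h0 hq)) hq'.symm
  -- This is `w σ(w) = b'` without denominators, read as a polynomial identity because `z` is
  -- transcendental.
  have key : p * p' = C b' * (q * q') := by
    apply hinj
    rw [map_mul, map_mul, map_mul, aeval_C, hp', hq', h, map_mul, ← hw]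
    ring
  have hdvd : q ∣ p' := hpq.symm.dvd_of_dvd_mul_left (key ▸ ((dvd_mul_right q q').mul_left _))
  have hdvd' : p ∣ q' := by
    have h1 : p ∣ q * q' := by
      have : p ∣ C b' * (q * q') := key ▸ dvd_mul_right p p'
      rwa [(isUnit_C.2 (isUnit_iff_ne_zero.2 hb')).dvd_mul_left] at this
    exact hpq.dvd_of_dvd_mul_left h1
  obtain ⟨u, rfl⟩ := hdvd
  obtain ⟨v, rfl⟩ := hdvd'
  have huv : u = C b' * v := by
    apply mul_left_cancel₀ (mul_ne_zero hp hq)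
    linear_combination key
  have hu0 := right_ne_zero_of_mul hp'0
  have hv0 := right_ne_zero_of_mul hq'0
  -- Both `q * u` and `p * v` have degree at most `d`, and `u`, `v` have equal degrees. As `p` or
  -- `q` already has degree `d`, nothing is left for `v`.
  have hvd : v.natDegree = 0 := by
    have huvd : u.natDegree = v.natDegree := by rw [huv, natDegree_C_mul hb']
    rw [natDegree_mul hq hu0] at hp'd
    rw [natDegree_mul hp hv0] at hq'd
    omega
  obtain ⟨e, rfl⟩ : ∃ e, v = C e := ⟨_, eq_C_of_natDegree_eq_zero hvd⟩
  refine ⟨b' * e, ?_⟩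
  rw [huv, ← C_mul, map_mul, aeval_C] at hp'
  rw [map_mul, aeval_C] at hq'
  have h1 := congrArg σ hp'
  rw [map_mul σ, map_mul σ, map_pow σ, hσσ] at h1
  -- With `p' = b' e q` and `q' = e p`, applying the twisted reciprocal twice multiplies `p` by `b ^
  -- d`. This gives `b ^ d = σ(b' e) e`, so `b' b ^ d` is the norm of `b' e`.
  have h2 : algebraMap F M b ^ d * aeval z p = σ (algebraMap F M (b' * e)) *
      (aeval z p * algebraMap F M e) := by
    rw [← hz, mul_pow, mul_assoc, ← h1, hq']
    ring
  have h3 : algebraMap F M b ^ d = σ (algebraMap F M (b' * e)) * algebraMap F M e :=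
    mul_right_cancel₀ (h0 hp) (by rw [h2]; ring)
  have h4 : algebraMap F M (b' * b ^ d) = algebraMap F M b' * algebraMap F M b ^ d := by
    rw [map_mul, map_pow]
  rw [h4, h3, map_mul]
  ring

end Norm

section Iso

open scoped Polynomial.Bivariate

variable {K L L' : Type*} [Field K] [Field L] [Algebra K L] [Field L'] [Algebra K L']
  {a b : K} {x y : L} {x' y' : L'}

/-- The equation of a conic generates the relations between its two generators. -/
lemma IsConic.aevalAeval_eq_zero (h : IsConic a b x y)
    (h' : y' ^ 2 = algebraMap K L' a * x' ^ 2 + algebraMap K L' b) {f : K[X][Y]}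
    (hf : aevalAeval x y f = 0) : aevalAeval x' y' f = 0 := by
  set r : K[X][Y] := Y ^ 2 - C (C a * X ^ 2 + C b) with hr
  have hm : r.Monic := monic_X_pow_sub_C _ two_ne_zero
  have hdeg : r.natDegree = 2 := natDegree_X_pow_sub_C
  have hr0 : aevalAeval x y r = 0 := by
    rw [hr, map_sub, map_pow, aevalAeval_Y, aevalAeval_C, h.sq_eq]
    simp
  have hr0' : aevalAeval x' y' r = 0 := by
    rw [hr, map_sub, map_pow, aevalAeval_Y, aevalAeval_C, h']
    simp
  obtain ⟨u, v, huv⟩ : ∃ u v : K[X], f %ₘ r = C u * Y + C v := by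
    have : (f %ₘ r).natDegree ≤ 1 := by
      have := natDegree_modByMonic_lt f hm (fun h1 => by simp [h1] at hdeg)
      omega
    obtain ⟨u, v, h⟩ := exists_eq_X_add_C_of_natDegree_le_one this
    exact ⟨u, v, h⟩
  rw [← modByMonic_add_div f r, huv] at hf ⊢
  rw [map_add, map_mul _ r, hr0, zero_mul, add_zero, map_add, map_mul, aevalAeval_C, aevalAeval_C,
    aevalAeval_Y] at hf
  -- The remainder gives `u(x) y + v(x) = 0`, hence `v² = u² (a X² + b)`. If `u ≠ 0`, comparing
  -- leading coefficients makes `a` a square.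
  have h0 : v ^ 2 = u ^ 2 * (C a * X ^ 2 + C b) := by
    apply transcendental_iff_injective.1 h.transcendental
    simp only [map_mul, map_pow, map_add, aeval_C, aeval_X]
    rw [← h.sq_eq]
    linear_combination (aeval x v - aeval x u * y) * hf
  have ha : a ≠ 0 := by
    rintro rfl
    exact h.ne_sq 0 (by simp)
  have hu : u = 0 := by
    by_contra hu
    have h1 := congrArg Polynomial.leadingCoeff h0
    have h2 : (C a * X ^ 2 + C b).leadingCoeff = a := by
      have := leadingCoeff_quadratic (b := 0) (c := b) ha
      simpa using this
    rw [Polynomial.leadingCoeff_mul, h2, leadingCoeff_pow, leadingCoeff_pow] at h1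
    have hu' : u.leadingCoeff ≠ 0 := leadingCoeff_ne_zero.2 hu
    apply h.ne_sq (algebraMap K L (v.leadingCoeff / u.leadingCoeff))
    rw [← map_pow, div_pow, h1]
    congr 1
    field_simp
  have hv : v = 0 := by
    rw [hu] at h0
    simpa using h0
  rw [hu, hv, map_add, map_mul _ r, hr0']
  simp

/-- A field generated by a subring maps to every field in which the same relations hold. -/
lemma exists_algHom_of_ker_eq {A : Type*} [CommRing A] [Algebra K A] (φ : A →ₐ[K] L)
    (φ' : A →ₐ[K] L') (hker : ∀ f, φ' f = 0 ↔ φ f = 0) (hdiv : ∀ c, ∃ f g, c = φ' f / φ' g) :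
    ∃ Ψ : L' →ₐ[K] L, ∀ f, Ψ (φ' f) = φ f := by
  have hk : RingHom.ker φ' = RingHom.ker φ := by
    ext f
    exact hker f
  let I := RingHom.ker φ'
  let ψ : A ⧸ I →ₐ[K] L := Ideal.Quotient.liftₐ I φ fun f hf => (hker f).1 hf
  let ψ' : A ⧸ I →ₐ[K] L' := Ideal.Quotient.liftₐ I φ' fun f hf => hf
  have hψ : Function.Injective ψ := RingHom.lift_injective_of_ker_le_ideal I _ hk.ge
  have hψ' : Function.Injective ψ' := RingHom.lift_injective_of_ker_le_ideal I _ le_rfl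
  let _ : Algebra (A ⧸ I) L' := ψ'.toRingHom.toAlgebra
  have : IsScalarTower K (A ⧸ I) L' := .of_algebraMap_eq fun c => (ψ'.commutes c).symm
  have : FaithfulSMul (A ⧸ I) L' := (faithfulSMul_iff_algebraMap_injective _ _).2 hψ'
  have : IsDomain (A ⧸ I) := hψ'.isDomain ψ'.toRingHom
  have : IsFractionRing (A ⧸ I) L' := by
    apply IsFractionRing.of_field
    intro c
    obtain ⟨f, g, rfl⟩ := hdiv c
    exact ⟨Ideal.Quotient.mk I f, Ideal.Quotient.mk I g, rfl⟩
  exact ⟨IsFractionRing.liftAlgHom hψ, fun f =>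
    IsFractionRing.lift_algebraMap hψ (Ideal.Quotient.mk I f)⟩

/-- Function fields of conics with the same equation are isomorphic. -/
theorem IsConic.nonempty_algEquiv (h : IsConic a b x y) (h' : IsConic a b x' y') :
    Nonempty (L' ≃ₐ[K] L) := by
  have hdiv : ∀ c : L', ∃ f g : K[X][Y], c = aevalAeval x' y' f / aevalAeval x' y' g := by
    intro c
    have hc : c ∈ adjoin K {x', y'} := h'.adjoin_eq_top ▸ mem_top
    rw [mem_adjoin_iff_div] at hc
    obtain ⟨r, hr, s, hs, rfl⟩ := hc
    have hle : Algebra.adjoin K {x', y'} ≤ (aevalAeval (R := K) x' y').range := by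
      rw [Algebra.adjoin_le_iff]
      rintro _ (rfl | rfl)
      · exact ⟨C X, aevalAeval_X _ _⟩
      · exact ⟨Y, aevalAeval_Y _ _⟩
    obtain ⟨f, rfl⟩ := hle hr
    obtain ⟨g, rfl⟩ := hle hs
    exact ⟨f, g, rfl⟩
  obtain ⟨Ψ, hΨ⟩ := exists_algHom_of_ker_eq (aevalAeval (R := K) x y) (aevalAeval (R := K) x' y')
    (fun f => ⟨h'.aevalAeval_eq_zero h.sq_eq, h.aevalAeval_eq_zero h'.sq_eq⟩) hdiv
  have htop : (⊤ : IntermediateField K L) ≤ Ψ.fieldRange := by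
    rw [← h.adjoin_eq_top, adjoin_le_iff]
    rintro _ (rfl | rfl)
    · exact ⟨_, (hΨ (C X)).trans (aevalAeval_X _ _)⟩
    · exact ⟨_, (hΨ Y).trans (aevalAeval_Y _ _)⟩
  exact ⟨AlgEquiv.ofBijective Ψ ⟨Ψ.toRingHom.injective, fun c => htop (mem_top (x := c))⟩⟩

/-- Multiplication by an element of `K(√a)` transforms conics. -/
lemma IsConic.transform (h : IsConic a b x y) {x₀ y₀ : K} (h0 : y₀ ^ 2 - a * x₀ ^ 2 ≠ 0) :
    IsConic a ((y₀ ^ 2 - a * x₀ ^ 2) * b) (algebraMap K L y₀ * x + algebraMap K L x₀ * y)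
      (algebraMap K L y₀ * y + algebraMap K L (a * x₀) * x) := by
  have h0' : algebraMap K L (y₀ ^ 2 - a * x₀ ^ 2) ≠ 0 := (_root_.map_ne_zero _).2 h0
  -- These are the coordinates of `Y' + √a X' = (y₀ + √a x₀)(y + √a x)`; taking norms gives the new
  -- equation, and multiplying by the conjugate `y₀ - √a x₀` inverts the change of variables.
  set X' := algebraMap K L y₀ * x + algebraMap K L x₀ * y with hX
  set Y' := algebraMap K L y₀ * y + algebraMap K L (a * x₀) * x with hY
  have hsq : Y' ^ 2 = algebraMap K L a * X' ^ 2 +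
      algebraMap K L ((y₀ ^ 2 - a * x₀ ^ 2) * b) := by
    simp only [hX, hY, map_mul, map_sub, map_pow]
    linear_combination (algebraMap K L y₀ ^ 2 - algebraMap K L a * algebraMap K L x₀ ^ 2) * h.sq_eq
  have hx : x = (algebraMap K L y₀ * X' - algebraMap K L x₀ * Y') /
      algebraMap K L (y₀ ^ 2 - a * x₀ ^ 2) := by
    rw [eq_div_iff h0']
    simp only [hX, hY, map_mul, map_sub, map_pow]
    ring
  have hy : y = (algebraMap K L y₀ * Y' - algebraMap K L (a * x₀) * X') /
      algebraMap K L (y₀ ^ 2 - a * x₀ ^ 2) := by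
    rw [eq_div_iff h0']
    simp only [hX, hY, map_mul, map_sub, map_pow]
    ring
  refine ⟨hsq, h.ne_sq, ?_, ?_⟩
  · intro hX'
    have hY' : IsAlgebraic K Y' := by
      refine .of_pow (n := 2) two_pos ?_
      rw [hsq]
      exact ((isAlgebraic_algebraMap a).mul (hX'.pow 2)).add (isAlgebraic_algebraMap _)
    apply h.transcendental
    rw [hx, div_eq_mul_inv]
    exact (((isAlgebraic_algebraMap y₀).mul hX').sub ((isAlgebraic_algebraMap x₀).mul hY')).mul
      (isAlgebraic_algebraMap _).inv
  · rw [eq_top_iff, ← h.adjoin_eq_top, adjoin_le_iff]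
    set N := adjoin K {X', Y'}
    have hXN : X' ∈ N := subset_adjoin K _ (by simp)
    have hYN : Y' ∈ N := subset_adjoin K _ (by simp)
    rintro _ (rfl | rfl)
    · rw [hx]
      exact div_mem (sub_mem (mul_mem (N.algebraMap_mem _) hXN) (mul_mem (N.algebraMap_mem _) hYN))
        (N.algebraMap_mem _)
    · rw [hy]
      exact div_mem (sub_mem (mul_mem (N.algebraMap_mem _) hYN) (mul_mem (N.algebraMap_mem _) hXN))
        (N.algebraMap_mem _)

end Iso

end CurveModel

/-! ### Parity of the degree -/

namespace CurveModel

open Module Polynomial IntermediateField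

variable {K L' : Type*} {L : Type u} [Field K] [Field L] [Algebra K L] [Field L'] [Algebra K L']
  {a b b' : K} {x y : L} {x' y' : L'}

/-- A quadratic extension with its conjugation. -/
lemma exists_sqrt_extension {L : Type u} [Field L] {a : L} (ha : ∀ c : L, c ^ 2 ≠ a) :
    ∃ (M : Type u) (_ : Field M) (_ : Algebra L M) (s : M) (σ : M →ₐ[L] M),
      s ^ 2 = algebraMap L M a ∧ σ s = -s ∧ L⟮s⟯ = ⊤ := by
  have : Fact (Irreducible (X ^ 2 - C a : L[X])) :=
    ⟨X_pow_sub_C_irreducible_of_prime Nat.prime_two ha⟩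
  have hs : AdjoinRoot.root (X ^ 2 - C a : L[X]) ^ 2 = algebraMap L _ a := by
    have := AdjoinRoot.eval₂_root (X ^ 2 - C a : L[X])
    rw [eval₂_sub, eval₂_pow, eval₂_X, eval₂_C] at this
    exact sub_eq_zero.1 this
  have h0 : (X ^ 2 - C a : L[X]).eval₂ (Algebra.ofId L (AdjoinRoot (X ^ 2 - C a : L[X])))
      (-AdjoinRoot.root (X ^ 2 - C a : L[X])) = 0 := by
    rw [eval₂_sub, eval₂_pow, eval₂_X, eval₂_C, neg_sq, hs]
    exact sub_self _
  exact ⟨AdjoinRoot (X ^ 2 - C a : L[X]), AdjoinRoot.instField, inferInstance,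
    AdjoinRoot.root (X ^ 2 - C a : L[X]),
    AdjoinRoot.liftAlgHom _ (Algebra.ofId L _) (-AdjoinRoot.root (X ^ 2 - C a : L[X])) h0, hs,
    AdjoinRoot.liftAlgHom_root _ _ _ h0, adjoin_eq_top_of_algebra _ _ AdjoinRoot.adjoinRoot_eq_top⟩

/-- Let `L` be an extension of `L'`, where both are function fields of conics that split over the
same quadratic extension. Then the degree of `L` over `L'` is odd, and the conics are isomorphic,
unless that of `L'` has a rational point. -/
theorem IsConic.odd_finrank [Algebra L' L] [IsScalarTower K L' L] (h : IsConic a b x y)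
    (h' : IsConic a b' x' y') (h2 : (2 : K) ≠ 0)
    (hb' : ¬∃ x₀ y₀ : K, y₀ ^ 2 = a * x₀ ^ 2 + b') :
    Odd (finrank L' L) ∧ Nonempty (L' ≃ₐ[K] L) := by
  obtain ⟨M, _, _, s, σ, hsL, hσs, hM⟩ := exists_sqrt_extension h.ne_sq
  let _ : Algebra K M := ((algebraMap L M).comp (algebraMap K L)).toAlgebra
  have : IsScalarTower K L M := .of_algebraMap_eq fun _ => rfl
  let _ : Algebra L' M := ((algebraMap L M).comp (algebraMap L' L)).toAlgebra
  have : IsScalarTower L' L M := .of_algebraMap_eq fun _ => rfl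
  have : IsScalarTower K L' M := .of_algebraMap_eq fun c => by
    rw [IsScalarTower.algebraMap_apply K L M, IsScalarTower.algebraMap_apply K L' L,
      IsScalarTower.algebraMap_apply L' L M]
  have hs : s ^ 2 = algebraMap K M a := hsL
  have hσL' : ∀ c : L', σ (algebraMap L' M c) = algebraMap L' M c := fun c => by
    rw [IsScalarTower.algebraMap_apply L' L M, σ.commutes]
  have hσK : ∀ c : K, σ (algebraMap K M c) = algebraMap K M c := fun c => by
    rw [IsScalarTower.algebraMap_apply K L M, σ.commutes]
  have hσσ : ∀ m, σ (σ m) = m := by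
    have : (AlgHom.equalizer (σ.comp σ) (AlgHom.id L M)) = ⊤ := by
      rw [eq_top_iff, ← top_toSubalgebra, ← hM, adjoin_simple_toSubalgebra_of_isAlgebraic,
        Algebra.adjoin_le_iff]
      · rintro _ rfl
        simp [hσs]
      · exact ⟨X ^ 2 - C _, X_pow_sub_C_ne_zero two_pos (algebraMap K L a), by simp [hsL]⟩
    intro m
    have hm : m ∈ (AlgHom.equalizer (σ.comp σ) (AlgHom.id L M)) := this ▸ Algebra.mem_top
    exact hm
  set z := algebraMap L M y - s * algebraMap L M x with hz
  set w := algebraMap L' M y' - s * algebraMap L' M x' with hw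
  have hσz : z * σ z = algebraMap K M b := by
    rw [← h.mul_eq hs, hz, map_sub, map_mul, σ.commutes, σ.commutes, hσs]
    ring
  have hσw : w * σ w = algebraMap K M b' := by
    rw [← h'.mul_eq hs, hw, map_sub, map_mul, hσL', hσL', hσs]
    ring
  have htop : K⟮s⟯⟮z⟯ = ⊤ := by
    have := h.adjoin_sqrt_eq h2 hs
    rw [hM, top_toSubfield] at this
    exact toSubfield_injective (this.symm.trans top_toSubfield.symm)
  obtain ⟨p, q, hpq, hq, hwpq, hfin⟩ := exists_finrank_adjoin_eq (h.transcendental_sub h2 hs) htop w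
  have hnorm : ∀ e ∈ K⟮s⟯, ∃ x₀ y₀ : K, e = algebraMap K M y₀ - s * algebraMap K M x₀ ∧
      σ e = algebraMap K M y₀ + s * algebraMap K M x₀ := by
    intro e he
    obtain ⟨y₀, x₀, rfl⟩ := mem_adjoin_sqrt hs he
    refine ⟨x₀, y₀, rfl, ?_⟩
    rw [map_sub, map_mul, hσK, hσK, hσs]
    ring
  have hnormmul : ∀ {e : M} {x₀ y₀ : K}, e = algebraMap K M y₀ - s * algebraMap K M x₀ →
      σ e = algebraMap K M y₀ + s * algebraMap K M x₀ →
      e * σ e = algebraMap K M (y₀ ^ 2 - a * x₀ ^ 2) := by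
    intro e x₀ y₀ h1 h2
    rw [h2, h1, map_sub, map_mul, map_pow, map_pow, ← hs]
    ring
  obtain ⟨e, he⟩ := exists_mul_pow_eq_norm (F := K⟮s⟯) σ.toRingHom (fun c => by
      obtain ⟨x₀, y₀, -, h1⟩ := hnorm c c.2
      refine ⟨⟨σ c, ?_⟩, rfl⟩
      rw [h1]
      exact add_mem (K⟮s⟯.algebraMap_mem _)
        (mul_mem (mem_adjoin_simple_self K s) (K⟮s⟯.algebraMap_mem _))) hσσ
    (h.transcendental_sub h2 hs) (b := algebraMap K _ b) (b' := algebraMap K _ b') hσz hσw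
    (by simpa using h.ne_zero) (by simpa using h'.ne_zero) hpq hq hwpq
  -- The degree `[M : L']` is computed through `L` and through `L'(√a) = K(√a)(w)`; both
  -- intermediate steps contribute a factor 2.
  have hdeg : finrank L' L = max p.natDegree q.natDegree := by
    have h1 : finrank L M = 2 := by
      rw [← finrank_adjoin_sqrt hsL h.ne_sq, hM, finrank_top']
    have h3 : finrank L' L'⟮s⟯ = 2 :=
      finrank_adjoin_sqrt (by rw [hs, IsScalarTower.algebraMap_apply K L' M]) h'.ne_sq
    have h4 : finrank L'⟮s⟯ M = max p.natDegree q.natDegree := by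
      rw [← hfin]
      exact finrank_eq_of_toSubfield_eq (h'.adjoin_sqrt_eq h2 hs)
    have h5 := finrank_mul_finrank L' L M
    rw [← finrank_mul_finrank L' L'⟮s⟯ M, h1, h3, h4] at h5
    omega
  set d := max p.natDegree q.natDegree
  -- Dividing `e` by `b ^ k` divides its norm by `b ^ (2 * k)`.
  have hdiv : ∀ k : ℕ, ∃ x₀ y₀ : K, b' * b ^ d = (y₀ ^ 2 - a * x₀ ^ 2) * b ^ (2 * k) := by
    intro k
    have hbk : algebraMap K M b ≠ 0 := by simpa using h.ne_zero
    obtain ⟨x₀, y₀, h3, h4⟩ := hnorm (e * (algebraMap K M b ^ k)⁻¹)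
      (mul_mem e.2 (inv_mem (pow_mem (K⟮s⟯.algebraMap_mem b) k)))
    have h5 := hnormmul h3 h4
    refine ⟨x₀, y₀, (algebraMap K M).injective ?_⟩
    rw [map_mul _ (_ - _), ← h5, map_mul σ, map_inv₀, map_pow, map_pow, hσK]
    have h6 : (e : M) * σ e = algebraMap K M (b' * b ^ d) := by
      have : algebraMap K⟮s⟯ M (algebraMap K _ b' * algebraMap K _ b ^ d) =
        algebraMap K M (b' * b ^ d) := by rw [← map_pow, ← map_mul]; rfl
      exact he.trans this
    rw [← h6, pow_mul']
    field_simp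
  have hodd : Odd d := by
    by_contra hd
    obtain ⟨k, hk⟩ := Nat.not_odd_iff_even.1 hd
    -- For `d = 2k`, `b'` itself is a norm `y₀² - a x₀²`, which is a rational solution of the second
    -- conic.
    obtain ⟨x₀, y₀, h3⟩ := hdiv k
    rw [hk, ← two_mul] at h3
    exact hb' ⟨x₀, y₀, by
      linear_combination -mul_right_cancel₀ (pow_ne_zero _ h.ne_zero) h3⟩
  refine ⟨hdeg ▸ hodd, ?_⟩
  obtain ⟨k, hk⟩ := hodd
  -- For `d = 2k + 1`, the exponent `2(k + 1) = d + 1` leaves exactly one factor `b`.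
  obtain ⟨x₀, y₀, h3⟩ := hdiv (k + 1)
  have h4 : b' = (y₀ ^ 2 - a * x₀ ^ 2) * b := by
    apply mul_right_cancel₀ (pow_ne_zero d h.ne_zero)
    rw [h3, hk]
    ring
  have h5 : y₀ ^ 2 - a * x₀ ^ 2 ≠ 0 := left_ne_zero_of_mul (h4 ▸ h'.ne_zero)
  exact (h.transform h5).nonempty_algEquiv (h4 ▸ h')

end CurveModel

/-! ### Smooth local rings of dimension at most one -/

namespace CurveModel

open IsLocalRing Module KaehlerDifferential TensorProduct

set_option linter.unusedSectionVars false

section Smooth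

variable {K A : Type*} [Field K] [PerfectField K] [CommRing A] [IsDomain A] [Algebra K A]

/-- A regularity criterion: a local domain that is smooth of dimension at most one over a perfect
field is a field or a discrete valuation ring. -/
lemma isDiscreteValuationRing_of_formallySmooth [IsLocalRing A] [IsNoetherianRing A]
    [Algebra.FormallySmooth K A] [Algebra.EssFiniteType K A] (hA : ¬IsField A) {ω : Ω[A⁄K]}
    (hω : Submodule.span A {ω} = ⊤) : IsDiscreteValuationRing A := by
  have hker : RingHom.ker (algebraMap A (ResidueField A)) = maximalIdeal A := ker_residue
  have : Algebra.EssFiniteType A (ResidueField A) := .of_surjective (Algebra.ofId _ _)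
    residue_surjective
  have : Algebra.EssFiniteType K (ResidueField A) := .comp K A _
  have : Algebra.FormallySmooth K (ResidueField A) := inferInstance
  -- As `K` is perfect, the residue field is formally smooth, so the cotangent space injects with a
  -- retraction `l` into `κ ⊗ Ω`. The latter is spanned by `1 ⊗ ω`, so the image of that element
  -- under `l` spans the cotangent space.
  obtain ⟨l, hl⟩ := (Algebra.FormallySmooth.iff_split_injection (R := K) (P := A)
    (A := ResidueField A) residue_surjective).1 this
  have hsurj : Function.Surjective l := fun x => ⟨_, LinearMap.congr_fun hl x⟩
  have hspan : Submodule.span A {(1 : ResidueField A) ⊗ₜ[A] ω} = ⊤ := by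
    rw [eq_top_iff]
    intro x _
    induction x using TensorProduct.induction_on with
    | zero => exact zero_mem _
    | add x y hx hy => exact add_mem (hx trivial) (hy trivial)
    | tmul c η =>
      obtain ⟨c, rfl⟩ := residue_surjective c
      obtain ⟨d, rfl⟩ := Submodule.mem_span_singleton.1 (hω.symm ▸ Submodule.mem_top : η ∈ _)
      refine Submodule.mem_span_singleton.2 ⟨c * d, ?_⟩
      rw [mul_comm, mul_smul, TensorProduct.tmul_smul, TensorProduct.smul_tmul',
        Algebra.smul_def, mul_one]
      rfl
  apply ((IsDiscreteValuationRing.TFAE A hA).out 4 0).1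
  obtain ⟨⟨t, ht⟩, htl⟩ := Ideal.toCotangent_surjective _ (l ((1 : ResidueField A) ⊗ₜ[A] ω))
  refine ⟨t, le_antisymm ?_ ?_⟩
  -- Nakayama: a lift `t` of a generator of the cotangent space generates the maximal ideal.
  · refine Submodule.le_of_le_smul_of_le_jacobson_bot (I := maximalIdeal A)
      (IsNoetherian.noetherian _) (jacobson_eq_maximalIdeal ⊥ bot_ne_top).ge fun x hx => ?_
    have hx' : x ∈ RingHom.ker (algebraMap A (ResidueField A)) := hker ▸ hx
    obtain ⟨y, hy⟩ := hsurj (Ideal.toCotangent _ ⟨x, hx'⟩)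
    obtain ⟨c, rfl⟩ := Submodule.mem_span_singleton.1 (hspan.symm ▸ Submodule.mem_top : y ∈ _)
    rw [map_smul, ← htl, ← map_smul, Ideal.toCotangent_eq] at hy
    rw [← sub_sub_cancel (c * t) x]
    refine sub_mem (Submodule.mem_sup_left (Ideal.mem_span_singleton.2 (dvd_mul_left t c)))
      (Submodule.mem_sup_right ?_)
    rw [smul_eq_mul, ← pow_two]
    change c * t - x ∈ _ at hy
    rwa [hker] at hy
  · rw [Submodule.span_singleton_le_iff_mem]
    exact hker ▸ ht

/-- The differentials of a standard smooth algebra of relative dimension one are free of rank one,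
and differentials commute with localization. -/
lemma exists_span_kaehler {B : Type*} [CommRing B] [IsDomain B] [Algebra K B] [Algebra B A]
    [IsScalarTower K B A] (M : Submonoid B) [IsLocalization M A]
    [Algebra.IsStandardSmoothOfRelativeDimension 1 K B] :
    ∃ ω : Ω[A⁄K], Submodule.span A {ω} = ⊤ := by
  have : Algebra.IsStandardSmooth K B :=
    Algebra.IsStandardSmoothOfRelativeDimension.isStandardSmooth 1
  have hr := Algebra.IsStandardSmoothOfRelativeDimension.rank_kaehlerDifferential (R := K)
    (S := B) 1
  have hfr : Module.finrank B Ω[B⁄K] = 1 := by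
    rw [Module.finrank, hr]; simp
  obtain ⟨ω, h0, hω⟩ := finrank_eq_one_iff'.1 hfr
  refine ⟨KaehlerDifferential.map K K B A ω, ?_⟩
  have := span_eq_top_of_isLocalizedModule A M (KaehlerDifferential.map K K B A) (v := {ω}) (by
    rw [eq_top_iff]
    intro x _
    exact Submodule.mem_span_singleton.2 (hω x))
  rwa [Set.image_singleton] at this

theorem isDiscreteValuationRing_of_isStandardSmooth {B : Type*} [CommRing B] [IsDomain B]
    [Algebra K B] [Algebra B A] [IsScalarTower K B A] [IsLocalRing A] (M : Submonoid B)
    [IsLocalization M A] [Algebra.IsStandardSmoothOfRelativeDimension 1 K B] (hA : ¬IsField A) :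
    IsDiscreteValuationRing A := by
  have : Algebra.IsStandardSmooth K B :=
    Algebra.IsStandardSmoothOfRelativeDimension.isStandardSmooth 1
  have : Algebra.FormallySmooth B A := .of_isLocalization M
  have : Algebra.FormallySmooth K A := .comp K B A
  have : IsNoetherianRing B := Algebra.FiniteType.isNoetherianRing K B
  have : IsNoetherianRing A := IsLocalization.isNoetherianRing M A inferInstance
  have : Algebra.EssFiniteType B A := .of_isLocalization A M
  have : Algebra.EssFiniteType K A := .comp K B A
  obtain ⟨ω, hω⟩ := exists_span_kaehler (K := K) (A := A) M
  exact isDiscreteValuationRing_of_formallySmooth hA hω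

end Smooth

end CurveModel

/-! ### Points and local rings of a smooth curve -/

namespace CurveModel

open IsLocalRing Module

variable {K : Type u} [Field K]

lemma eq_top_of_mem_spec {U : (Spec (.of K)).Opens} {y : Spec (.of K)} (hy : y ∈ U) :
    U = ⊤ := by
  ext z
  have : Subsingleton (Spec (.of K)) := inferInstanceAs (Subsingleton (PrimeSpectrum K))
  simpa [Subsingleton.elim z y] using hy

/-- The local rings of a smooth curve over a perfect field are fields or discrete valuation
rings. -/
lemma isDiscreteValuationRing_stalk [PerfectField K] {X : Scheme.{u}} [IsIntegral X]
    (f : X ⟶ Spec (.of K)) [SmoothOfRelativeDimension 1 f] (x : X)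
    (hx : ¬IsField (X.presheaf.stalk x)) : IsDiscreteValuationRing (X.presheaf.stalk x) := by
  obtain ⟨U, hU, V, hV, hxV, e, h⟩ :=
    SmoothOfRelativeDimension.exists_isStandardSmoothOfRelativeDimension (n := 1) (f := f) x
  obtain rfl := eq_top_of_mem_spec (e hxV)
  have : Nonempty V := ⟨⟨x, hxV⟩⟩
  let φ : K →+* Γ(X, V) := ((Scheme.ΓSpecIso (.of K)).inv ≫ f.appLE ⊤ V e).hom
  have hφ : φ.IsStandardSmoothOfRelativeDimension 1 :=
    RingHom.isStandardSmoothOfRelativeDimension_respectsIso.2 (f.appLE ⊤ V e).hom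
      (Scheme.ΓSpecIso (.of K)).symm.commRingCatIsoToRingEquiv h
  let _ : Algebra K Γ(X, V) := φ.toAlgebra
  let _ : Algebra Γ(X, V) (X.presheaf.stalk x) := (X.presheaf.germ V x hxV).hom.toAlgebra
  let _ : Algebra K (X.presheaf.stalk x) := ((X.presheaf.germ V x hxV).hom.comp φ).toAlgebra
  have : IsScalarTower K Γ(X, V) (X.presheaf.stalk x) := .of_algebraMap_eq fun _ => rfl
  have : Algebra.IsStandardSmoothOfRelativeDimension 1 K Γ(X, V) := hφ
  have := hV.isLocalization_stalk ⟨x, hxV⟩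
  exact isDiscreteValuationRing_of_isStandardSmooth (K := K) (B := Γ(X, V))
    (hV.primeIdealOf ⟨x, hxV⟩).asIdeal.primeCompl hx

/-- The spectrum of the stalk maps onto the generizations of `x`, among them `x` and the generic
point; the spectrum of a field has only one point. -/
lemma isField_stalk_iff {X : Scheme.{u}} [IsIntegral X] (x : X) :
    IsField (X.presheaf.stalk x) ↔ x = genericPoint X := by
  constructor
  · intro h
    let _ := h.toField
    have h1 : genericPoint X ∈ Set.range (X.fromSpecStalk x) := by
      rw [Scheme.range_fromSpecStalk]
      exact genericPoint_specializes x
    have h2 : x ∈ Set.range (X.fromSpecStalk x) := by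
      rw [Scheme.range_fromSpecStalk]
      exact specializes_rfl
    obtain ⟨p, hp⟩ := h1
    obtain ⟨q, hq⟩ := h2
    have : Subsingleton (Spec (X.presheaf.stalk x)) :=
      inferInstanceAs (Subsingleton (PrimeSpectrum (X.presheaf.stalk x)))
    exact hq.symm.trans ((congrArg _ (Subsingleton.elim q p)).trans hp)
  · rintro rfl
    exact Field.toIsField X.functionField

/-- The points other than the generic point are closed. -/
lemma isClosed_singleton [PerfectField K] {X : Scheme.{u}} [IsIntegral X]
    (f : X ⟶ Spec (.of K)) [SmoothOfRelativeDimension 1 f] (x : X)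
    (hx : x ≠ genericPoint X) : IsClosed {x} := by
  rw [← closure_subset_iff_isClosed]
  intro y hy
  rw [← specializes_iff_mem_closure] at hy
  by_contra hyx
  have hy' : y ≠ genericPoint X := by
    rintro rfl
    exact hx (hy.antisymm (genericPoint_specializes x)).eq
  have := isDiscreteValuationRing_stalk f y ((isField_stalk_iff y).not.2 hy')
  obtain ⟨p, hp⟩ : x ∈ Set.range (X.fromSpecStalk y) := by
    rw [Scheme.range_fromSpecStalk]
    exact hy
  obtain ⟨q, hq⟩ : genericPoint X ∈ Set.range (X.fromSpecStalk y) := by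
    rw [Scheme.range_fromSpecStalk]
    exact genericPoint_specializes y
  -- Only the closed point of the spectrum of the discrete valuation ring maps to `y`, so `x` and
  -- the generic point both come from the zero ideal.
  have key : ∀ r : Spec (X.presheaf.stalk y), X.fromSpecStalk y r ≠ y → r.asIdeal = ⊥ := by
    intro r hr
    by_contra h
    apply hr
    rw [show r = closedPoint (X.presheaf.stalk y) from
      PrimeSpectrum.ext (eq_maximalIdeal (r.isPrime.isMaximal h)), Scheme.fromSpecStalk_closedPoint]
  apply hx
  rw [← hp, ← hq]
  congr 1
  exact PrimeSpectrum.ext ((key p (hp ▸ fun h => hyx h.symm)).trans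
    (key q (hq ▸ fun h => hy' h.symm)).symm)

lemma finite_residueField {X : Scheme.{u}} 
    (f : X ⟶ Spec (.of K)) [LocallyOfFiniteType f] (x : X) (hx : IsClosed {x}) :
    IsFinite (X.fromSpecResidueField x ≫ f) := by
  have := isClosed_singleton_iff_isClosedImmersion.mp hx
  have : JacobsonSpace (Spec (.of K)) := inferInstance
  exact (isFinite_iff_locallyOfFiniteType_of_jacobsonSpace).2 inferInstance

end CurveModel

/-! ### Local rings inside the function field -/

namespace CurveModel

open IsLocalRing Module

variable {K : Type u} [Field K]

/-- The local rings of a scheme over `K` are `K`-algebras. -/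
noncomputable instance stalkAlgebra (X : Over (Spec (.of K))) (x : X.left) :
    Algebra K (X.left.presheaf.stalk x) :=
  ((X.left.presheaf.germ ⊤ x trivial).hom.comp (constants X)).toAlgebra

lemma algebraMap_stalk (X : Over (Spec (.of K))) (x : X.left) (c : K) :
    algebraMap K (X.left.presheaf.stalk x) c = X.left.presheaf.germ ⊤ x trivial (constants X c) :=
  rfl

/-- The structure morphism of a scheme over `K` is given by the constants. -/
lemma hom_eq_toSpecΓ (X : Over (Spec (.of K))) :
    X.hom = X.left.toSpecΓ ≫ Spec.map (CommRingCat.ofHom (constants X)) := by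
  have h : CommRingCat.ofHom (constants X) = (Scheme.ΓSpecIso (.of K)).inv ≫ X.hom.appTop := rfl
  rw [h, Spec.map_comp, ← Category.assoc]
  have := Scheme.toSpecΓ_naturality X.hom
  erw [← this]
  rw [Category.assoc, toSpecΓ_SpecMap_ΓSpecIso_inv]
  exact (Category.comp_id _).symm

lemma fromSpecStalk_hom (X : Over (Spec (.of K))) (x : X.left) :
    X.left.fromSpecStalk x ≫ X.hom =
      Spec.map (CommRingCat.ofHom (algebraMap K (X.left.presheaf.stalk x))) := by
  rw [hom_eq_toSpecΓ, ← Category.assoc, Scheme.fromSpecStalk_toSpecΓ, ← Spec.map_comp]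
  rfl

variable (X : Over (Spec (.of K))) [IsIntegral X.left]

/-- The inclusion of a local ring into the function field. -/
noncomputable def stalkToFunctionField (x : X.left) :
    X.left.presheaf.stalk x →ₐ[K] X.left.functionField where
  toRingHom := algebraMap (X.left.presheaf.stalk x) X.left.functionField
  commutes' c := by
    exact congrArg (fun φ => φ.hom (constants X c)) (X.left.presheaf.germ_stalkSpecializes (U := ⊤)
      (show x ∈ (⊤ : X.left.Opens) from trivial) (genericPoint_specializes x))

lemma stalkToFunctionField_injective (x : X.left) :
    Function.Injective (stalkToFunctionField X x) :=
  IsFractionRing.injective (X.left.presheaf.stalk x) X.left.functionField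

/-- The local ring of a point as a subring of the function field. -/
noncomputable def localRing (x : X.left) : Subalgebra K X.left.functionField :=
  (stalkToFunctionField X x).range

/-- A local ring is isomorphic to its image in the function field. -/
noncomputable def stalkEquiv (x : X.left) : X.left.presheaf.stalk x ≃ₐ[K] localRing X x :=
  AlgEquiv.ofInjective _ (stalkToFunctionField_injective X x)

lemma isFractionRing_localRing (x : X.left) :
    IsFractionRing (localRing X x) X.left.functionField := by
  apply IsFractionRing.of_field
  intro g
  obtain ⟨a, b, -, rfl⟩ := IsFractionRing.div_surjective (A := X.left.presheaf.stalk x) g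
  exact ⟨⟨_, a, rfl⟩, ⟨_, b, rfl⟩, rfl⟩

variable [PerfectField K] [SmoothOfRelativeDimension 1 X.hom]

/-- The closed points of a curve. -/
abbrev Place (X : Over (Spec (.of K))) [IsIntegral X.left] : Type u :=
  {x : X.left // x ≠ genericPoint X.left}

instance (p : Place X) : IsDiscreteValuationRing (X.left.presheaf.stalk p.1) :=
  isDiscreteValuationRing_stalk X.hom p.1 ((isField_stalk_iff p.1).not.2 p.2)

instance (p : Place X) : IsDiscreteValuationRing (localRing X p.1) :=
  IsDiscreteValuationRing.RingEquivClass.isDiscreteValuationRing (stalkEquiv X p.1)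

lemma finite_residueField_localRing (p : Place X) :
    Module.Finite K (ResidueField (localRing X p.1)) := by
  have : LocallyOfFiniteType X.hom := by
    have := SmoothOfRelativeDimension.smooth 1 X.hom
    infer_instance
  have h := finite_residueField X.hom p.1 (isClosed_singleton X.hom p.1 p.2)
  have : Module.Finite K (ResidueField (X.left.presheaf.stalk p.1)) := by
    rw [Scheme.fromSpecResidueField, Category.assoc, fromSpecStalk_hom, ← Spec.map_comp,
      IsFinite.SpecMap_iff] at h
    exact h
  exact .equiv (ResidueField.mapAlgEquiv (stalkEquiv X p.1)).toLinearEquiv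

end CurveModel

/-! ### Global functions are constant -/

namespace CurveModel

open IsLocalRing Module TensorProduct

variable {K : Type u} [Field K]

/-- A finite separable extension `E` of `K` for which `Spec (E ⊗ E)` is connected is trivial. -/
lemma algebraMap_surjective_of_connectedSpace {E : Type u} [Field E] [Algebra K E]
    [Module.Finite K E] [Algebra.IsSeparable K E] [ConnectedSpace (PrimeSpectrum (E ⊗[K] E))] :
    Function.Surjective (algebraMap K E) := by
  have : Algebra.FormallyUnramified K E := .of_isSeparable K E
  -- Separability splits the diagonal off: `E ⊗ E ≅ E × T`. Connectedness forces `T = 0`, so `[E :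
  -- K] = 1`.
  obtain ⟨T, _, _, ⟨e⟩⟩ := Algebra.FormallyUnramified.exists_algEquiv_prod K E
  have hconn : ConnectedSpace (PrimeSpectrum (E × T)) :=
    (PrimeSpectrum.homeomorphOfRingEquiv e.toRingEquiv).surjective.connectedSpace
      (PrimeSpectrum.homeomorphOfRingEquiv e.toRingEquiv).continuous
  have hidem : IsIdempotentElem ((1, 0) : E × T) := by simp [IsIdempotentElem]
  have hT : (1 : T) = 0 := by
    rcases isClopen_iff.1 (PrimeSpectrum.isClopen_iff.2 ⟨_, hidem, rfl⟩) with h | h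
    · have h0 : IsNilpotent ((1, 0) : E × T) :=
        PrimeSpectrum.basicOpen_eq_bot_iff _ |>.1 (TopologicalSpace.Opens.ext h)
      obtain ⟨n, hn⟩ := h0
      have := congrArg Prod.fst hn
      simp at this
    · by_contra hT
      have : Nontrivial T := ⟨1, 0, hT⟩
      let q : PrimeSpectrum T := Classical.arbitrary _
      have hq : PrimeSpectrum.comap (RingHom.snd E T) q ∈
          (PrimeSpectrum.basicOpen ((1, 0) : E × T) : Set _) := h ▸ Set.mem_univ _
      exact hq q.asIdeal.zero_mem
  have : Subsingleton T := subsingleton_of_zero_eq_one hT.symm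
  have h1 : finrank E (E ⊗[K] E) = 1 := by
    rw [e.toLinearEquiv.finrank_eq, finrank_prod, finrank_self, finrank_zero_of_subsingleton]
  rw [finrank_baseChange] at h1
  intro c
  have := Subalgebra.bot_eq_top_iff_finrank_eq_one.2 h1
  exact (Algebra.mem_bot.1 (this ▸ Algebra.mem_top : c ∈ (⊥ : Subalgebra K E)))

/-- The global functions of a proper geometrically connected integral scheme are constant. -/
lemma constants_surjective [PerfectField K] (X : Over (Spec (.of K))) [IsIntegral X.left]
    [IsProper X.hom] [GeometricallyConnected X.hom] : Function.Surjective (constants X) := by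
  let E := Γ(X.left, ⊤)
  let _ : Field E := (isField_of_universallyClosed K X.hom).toField
  let _ : Algebra K E := (constants X).toAlgebra
  have : Module.Finite K E := by
    have h := finite_appTop_of_universallyClosed K X.hom
    exact RingHom.Finite.comp h
      (.of_surjective _ (Scheme.ΓSpecIso (.of K)).symm.commRingCatIsoToRingEquiv.surjective)
  let h : Spec (.of E) ⟶ Spec (.of K) := Spec.map (CommRingCat.ofHom (algebraMap K E))
  let g : X.left ⟶ Spec (.of E) := X.left.toSpecΓ
  have hg : g ≫ h = X.hom := (hom_eq_toSpecΓ X).symm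
  have : Surjective g := ⟨fun y => by
    have : Subsingleton (Spec (.of E)) := inferInstanceAs (Subsingleton (PrimeSpectrum E))
    exact ⟨genericPoint X.left, Subsingleton.elim _ _⟩⟩
  -- The base change of `X` to the finite extension `E` of global functions is connected and maps
  -- onto `Spec (E ⊗ E)`.
  have : ConnectedSpace (Limits.pullback X.hom h : Scheme.{u}) :=
    pullback_of_geometrically GeometricallyConnected.geometrically_connectedSpace E h
  let m : Limits.pullback X.hom h ⟶ Limits.pullback h h :=
    Limits.pullback.map X.hom h h h g (𝟙 _) (𝟙 _) ((Category.comp_id _).trans hg.symm)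
      ((Category.comp_id _).trans (Category.id_comp _).symm)
  have : MorphismProperty.IsStableUnderComposition @Surjective.{u} :=
    ⟨fun _ _ _ _ => inferInstance⟩
  have : Surjective m := MorphismProperty.pullbackMap (P := @Surjective.{u})
    ‹Surjective g› (inferInstanceAs (Surjective (𝟙 _))) hg.symm (Category.id_comp _).symm
  let m' := m ≫ (pullbackSpecIso K E E).hom
  have : ConnectedSpace (PrimeSpectrum (E ⊗[K] E)) :=
    m'.surjective.connectedSpace m'.continuous
  exact algebraMap_surjective_of_connectedSpace (K := K) (E := E)

end CurveModel

/-! ### Sections as elements of the function field -/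

namespace CurveModel

open IsLocalRing Module Opposite

variable {K : Type u} [Field K]

/-- Functions on an open subset of an integral scheme are the elements of the function field that
lie in all local rings. -/
lemma exists_section (X : Over (Spec (.of K))) [IsIntegral X.left] {U : X.left.Opens} [Nonempty U]
    {g : X.left.functionField} (hg : ∀ x ∈ U, g ∈ localRing X x) :
    ∃ s : Γ(X.left, U), X.left.germToFunctionField U s = g := by
  have h : ∀ x : U, ∃ (W : X.left.Opens) (_ : W ≤ U) (_ : x.1 ∈ W) (hη : genericPoint X.left ∈ W)
      (s : Γ(X.left, W)), X.left.presheaf.germ W _ hη s = g := by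
    intro x
    obtain ⟨a, ha⟩ := hg x x.2
    obtain ⟨W, hxW, s, rfl⟩ := X.left.presheaf.exists_germ_eq a
    have hxW' : x.1 ∈ W ⊓ U := ⟨hxW, x.2⟩
    have hη : genericPoint X.left ∈ W ⊓ U :=
      (genericPoint_specializes x.1).mem_open (W ⊓ U).isOpen hxW'
    refine ⟨W ⊓ U, inf_le_right, hxW', hη,
      X.left.presheaf.map (homOfLE inf_le_left : W ⊓ U ⟶ W).op s, ?_⟩
    rw [← ha, TopCat.Presheaf.germ_res_apply]
    exact (X.left.presheaf.germ_stalkSpecializes_apply hxW (genericPoint_specializes x.1) s).symm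
  choose W hWU hxW hη s hs using h
  -- The local representatives agree on overlaps because all have germ `g` at the generic point.
  obtain ⟨t, ht, -⟩ := X.left.sheaf.existsUnique_gluing' W U (fun x => homOfLE (hWU x))
    (fun x hx => TopologicalSpace.Opens.mem_iSup.2 ⟨⟨x, hx⟩, hxW _⟩) s (by
      intro x y
      apply germ_injective_of_isIntegral X.left (genericPoint X.left) (U := W x ⊓ W y) ⟨hη x, hη y⟩
      erw [TopCat.Presheaf.germ_res_apply, TopCat.Presheaf.germ_res_apply]
      rw [hs, hs])
  refine ⟨t, ?_⟩
  have x : U := Classical.arbitrary U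
  rw [← hs x, ← ht x]
  exact (TopCat.Presheaf.germ_res_apply ..).symm

lemma germToFunctionField_mem_localRing (X : Over (Spec (.of K))) [IsIntegral X.left]
    {U : X.left.Opens} [Nonempty U] (s : Γ(X.left, U)) {x : X.left} (hx : x ∈ U) :
    X.left.germToFunctionField U s ∈ localRing X x :=
  ⟨X.left.presheaf.germ U x hx s,
    X.left.presheaf.germ_stalkSpecializes_apply hx (genericPoint_specializes x) s⟩

lemma mem_localRing_genericPoint (X : Over (Spec (.of K))) [IsIntegral X.left]
    (g : X.left.functionField) : g ∈ localRing X (genericPoint X.left) := by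
  refine ⟨g, ?_⟩
  change X.left.presheaf.stalkSpecializes _ g = g
  rw [TopCat.Presheaf.stalkSpecializes_refl]
  rfl

lemma mem_range_of_forall_mem_localRing [PerfectField K] (X : Over (Spec (.of K)))
    [IsIntegral X.left] [IsProper X.hom] [GeometricallyConnected X.hom]
    {g : X.left.functionField} (hg : ∀ x : Place X, g ∈ localRing X x.1) :
    g ∈ (algebraMap K X.left.functionField).range := by
  have : Nonempty (⊤ : X.left.Opens) := ⟨⟨genericPoint X.left, trivial⟩⟩
  obtain ⟨s, hs⟩ := exists_section X (U := ⊤) (g := g) fun x _ => by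
    by_cases h : x = genericPoint X.left
    · exact h ▸ mem_localRing_genericPoint X g
    · exact hg ⟨x, h⟩
  obtain ⟨c, rfl⟩ := constants_surjective X s
  exact ⟨c, hs⟩

end CurveModel

/-! ### Valuation rings and closed points -/

namespace CurveModel

open IsLocalRing Module Opposite

variable {K : Type u} [Field K]

/-- The valuative criterion for a proper scheme over a field. -/
lemma exists_lift (X : Over (Spec (.of K))) [IsProper X.hom] {R L : Type u} [CommRing R]
    [IsDomain R] [ValuationRing R] [Field L] [Algebra R L] [IsFractionRing R L] [Algebra K R] [Algebra K L]
    [IsScalarTower K R L] (i : Spec (.of L) ⟶ X.left)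
    (hi : i ≫ X.hom = Spec.map (CommRingCat.ofHom (algebraMap K L))) :
    ∃ l : Spec (.of R) ⟶ X.left, Spec.map (CommRingCat.ofHom (algebraMap R L)) ≫ l = i ∧
      l ≫ X.hom = Spec.map (CommRingCat.ofHom (algebraMap K R)) := by
  have h : (ValuativeCriterion ⊓ @QuasiCompact ⊓ @QuasiSeparated ⊓ @LocallyOfFiniteType :
      MorphismProperty Scheme.{u}) X.hom := by
    rw [← IsProper.eq_valuativeCriterion]
    infer_instance
  have := h.1.1.1.existence ⟨R, L, i, Spec.map (CommRingCat.ofHom (algebraMap K R)), ⟨by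
    rw [hi, ← Spec.map_comp, ← CommRingCat.ofHom_comp, ← IsScalarTower.algebraMap_eq]⟩⟩
  exact ⟨CommSq.lift _ (hsq := this), CommSq.fac_left _ (hsq := this),
    CommSq.fac_right _ (hsq := this)⟩

/-- Every nontrivial valuation ring of the function field of a smooth projective curve is the local
ring of a closed point. -/
lemma exists_place_of_valuationSubring [PerfectField K] (X : Over (Spec (.of K)))
    [IsIntegral X.left] [IsProper X.hom] [SmoothOfRelativeDimension 1 X.hom]
    (R : ValuationSubring X.left.functionField)
    (hK : ∀ c, algebraMap K X.left.functionField c ∈ R) (hR : R ≠ ⊤) :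
    ∃ p : Place X, ∀ g, g ∈ R ↔ g ∈ localRing X p.1 := by
  let _ : Algebra K R :=
    ((algebraMap K X.left.functionField).codRestrict R.toSubring hK).toAlgebra
  have : IsScalarTower K R X.left.functionField := .of_algebraMap_eq fun _ => rfl
  obtain ⟨l, hl, -⟩ := exists_lift X (R := R) (X.left.fromSpecStalk (genericPoint X.left))
    (fromSpecStalk_hom X _)
  let p := l (closedPoint R)
  let φ : X.left.presheaf.stalk p ⟶ .of R := Scheme.stalkClosedPointTo l
  have hφ : ∀ a, ((φ a : R) : X.left.functionField) = stalkToFunctionField X p a := by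
    have h1 : Spec.map (CommRingCat.ofHom (algebraMap R X.left.functionField)) ≫ Spec.map φ ≫
        X.left.fromSpecStalk p =
        Spec.map (X.left.presheaf.stalkSpecializes (genericPoint_specializes p)) ≫
          X.left.fromSpecStalk p := by
      rw [Scheme.Spec_stalkClosedPointTo_fromSpecStalk, hl,
        Scheme.SpecMap_stalkSpecializes_fromSpecStalk]
    rw [← Category.assoc, cancel_mono, ← Spec.map_comp] at h1
    intro a
    exact congrArg (fun ψ => ψ.hom a) (Spec.map_injective h1)
  have hle : ∀ g ∈ localRing X p, g ∈ R := by
    rintro _ ⟨a, rfl⟩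
    change stalkToFunctionField X p a ∈ R
    rw [← hφ a]
    exact (φ a).2
  have hp : p ≠ genericPoint X.left := by
    intro h
    apply hR
    rw [eq_top_iff]
    intro g _
    apply hle
    rw [h]
    exact mem_localRing_genericPoint X g
  refine ⟨⟨p, hp⟩, fun g => ⟨fun hg => ?_, hle g⟩⟩
  by_contra hgp
  have : IsDiscreteValuationRing (X.left.presheaf.stalk p) :=
    isDiscreteValuationRing_stalk X.hom p ((isField_stalk_iff p).not.2 hp)
  obtain ⟨a, ha⟩ | ⟨a, ha⟩ := ValuationRing.isInteger_or_isInteger (X.left.presheaf.stalk p) g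
  · exact hgp ⟨a, ha⟩
  -- The map from the stalk at the centre `p` to `R` is local. As `g⁻¹` becomes a unit in `R`, it is
  -- a unit of the stalk, so `g` lies in the stalk after all.
  · have hg0 : g ≠ 0 := by
      rintro rfl
      exact hgp (zero_mem _)
    have h1 : φ a * ⟨g, hg⟩ = (1 : R) := by
      apply Subtype.ext
      change ((φ a : R) : X.left.functionField) * g = 1
      rw [hφ]
      exact (congrArg (· * g) ha).trans (inv_mul_cancel₀ hg0)
    have h2 : IsUnit (φ.hom a) := .of_mul_eq_one _ h1
    obtain ⟨b, hb⟩ := ((isUnit_map_iff φ.hom a).1 h2).exists_right_inv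
    refine hgp ⟨b, ?_⟩
    have h3 := congrArg (stalkToFunctionField X p) hb
    rw [map_mul, map_one] at h3
    rw [← inv_inv g]
    exact eq_inv_of_mul_eq_one_right ((congrArg (· * stalkToFunctionField X p b) ha.symm).trans h3)

end CurveModel

/-! ### Principal parts from the vanishing of `H¹`, by Mayer–Vietoris -/

namespace CurveModel
open Opposite Limits Abelian

lemma free_hom_ext {X : Type u} {A : AddCommGrpCat.{u}} {f g : AddCommGrpCat.free.obj X ⟶ A}
    (h : ∀ x : X, f.hom (FreeAbelianGroup.of x) = g.hom (FreeAbelianGroup.of x)) : f = g :=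
  AddCommGrpCat.hom_ext (FreeAbelianGroup.lift_ext _ _ h)

section Abelian

variable {A : Type*} [Category* A] [Abelian A]

lemma subsingleton_ext_of_iso [HasExt.{u} A] {X Y Z : A} (e : X ≅ Y) {n : ℕ}
    [Subsingleton (Ext Y Z n)] : Subsingleton (Ext X Z n) := by
  refine subsingleton_of_forall_eq 0 fun x => ?_
  rw [← Ext.mk₀_id_comp x, ← e.hom_inv_id, ← Ext.mk₀_comp_mk₀, Ext.comp_assoc_of_second_deg_zero,
    Subsingleton.elim ((Ext.mk₀ e.inv).comp x (zero_add n)) 0, Ext.comp_zero]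

lemma biprod_lift_comp {X Y Z W : A} (f : X ⟶ Y) (g : X ⟶ Z) (h : Y ⊞ Z ⟶ W) :
    biprod.lift f g ≫ h = f ≫ biprod.inl ≫ h + g ≫ biprod.inr ≫ h := by
  rw [biprod.lift_eq, Preadditive.add_comp, Category.assoc, Category.assoc]

end Abelian

section Site

variable {C : Type u} [Category.{u} C] {J : GrothendieckTopology C}
  [HasSheafify J AddCommGrpCat.{u}]

/-- The section over `U` given by a homomorphism out of the free abelian sheaf on `U`. -/
noncomputable def evalFree (F : Sheaf J AddCommGrpCat.{u}) (U : C)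
    (φ : (presheafToSheaf J AddCommGrpCat.{u}).obj (yoneda.obj U ⋙ AddCommGrpCat.free) ⟶ F) :
    F.obj.obj (op U) :=
  (toSheafify J (yoneda.obj U ⋙ AddCommGrpCat.free) ≫ φ.hom).app (op U)
    (FreeAbelianGroup.of (𝟙 U))

lemma evalFree_add {F : Sheaf J AddCommGrpCat.{u}} {U : C}
    (φ ψ : (presheafToSheaf J AddCommGrpCat.{u}).obj (yoneda.obj U ⋙ AddCommGrpCat.free) ⟶ F) :
    evalFree F U (φ + ψ) = evalFree F U φ + evalFree F U ψ := rfl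

lemma evalFree_neg {F : Sheaf J AddCommGrpCat.{u}} {U : C}
    (φ : (presheafToSheaf J AddCommGrpCat.{u}).obj (yoneda.obj U ⋙ AddCommGrpCat.free) ⟶ F) :
    evalFree F U (-φ) = -evalFree F U φ := rfl

lemma evalFree_map {F : Sheaf J AddCommGrpCat.{u}} {U V : C} (i : U ⟶ V)
    (φ : (presheafToSheaf J AddCommGrpCat.{u}).obj (yoneda.obj V ⋙ AddCommGrpCat.free) ⟶ F) :
    evalFree F U ((presheafToSheaf J AddCommGrpCat.{u}).map
      (Functor.whiskerRight (yoneda.map i) AddCommGrpCat.free) ≫ φ) =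
      F.obj.map i.op (evalFree F V φ) := by
  have h := toSheafify_naturality J (Functor.whiskerRight (yoneda.map i) AddCommGrpCat.free)
  have e : toSheafify J (yoneda.obj U ⋙ AddCommGrpCat.free) ≫
      ((presheafToSheaf J AddCommGrpCat.{u}).map
      (Functor.whiskerRight (yoneda.map i) AddCommGrpCat.free) ≫ φ).hom =
      Functor.whiskerRight (yoneda.map i) AddCommGrpCat.free ≫
        (toSheafify J (yoneda.obj V ⋙ AddCommGrpCat.free) ≫ φ.hom) := by
    rw [← Category.assoc, h, Category.assoc]
    rfl
  have n := (toSheafify J (yoneda.obj V ⋙ AddCommGrpCat.free) ≫ φ.hom).naturality i.op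
  rw [evalFree, e, evalFree]
  have n' := ConcreteCategory.congr_hom n (FreeAbelianGroup.of (𝟙 V))
  refine Eq.trans ?_ n'
  rw [NatTrans.comp_app]
  refine congrArg (((toSheafify J (yoneda.obj V ⋙ AddCommGrpCat.free) ≫ φ.hom).app (op U)).hom) ?_
  change FreeAbelianGroup.map _ (FreeAbelianGroup.of _) =
    FreeAbelianGroup.map _ (FreeAbelianGroup.of _)
  rw [FreeAbelianGroup.map_of_apply, FreeAbelianGroup.map_of_apply]
  simp

lemma evalFree_surjective (F : Sheaf J AddCommGrpCat.{u}) (U : C) :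
    Function.Surjective (evalFree F U) := by
  intro s
  let α : yoneda.obj U ⋙ AddCommGrpCat.free ⟶ F.obj :=
    { app W := AddCommGrpCat.ofHom (FreeAbelianGroup.lift fun i : W.unop ⟶ U => F.obj.map i.op s)
      naturality W W' j := by
        refine free_hom_ext (X := W.unop ⟶ U) fun i => ?_
        change FreeAbelianGroup.lift _ (FreeAbelianGroup.map _ (FreeAbelianGroup.of i)) =
          F.obj.map j (FreeAbelianGroup.lift _ (FreeAbelianGroup.of i))
        rw [FreeAbelianGroup.map_of_apply, FreeAbelianGroup.lift_apply_of,
          FreeAbelianGroup.lift_apply_of, ← ConcreteCategory.comp_apply, ← F.obj.map_comp]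
        rfl }
  refine ⟨⟨sheafifyLift J α F.property⟩, ?_⟩
  change (toSheafify J _ ≫ sheafifyLift J α F.property).app _ _ = _
  rw [toSheafify_sheafifyLift]
  change FreeAbelianGroup.lift _ (FreeAbelianGroup.of (𝟙 U)) = s
  rw [FreeAbelianGroup.lift_apply_of]
  exact ConcreteCategory.congr_hom (F.obj.map_id (op U)) s

/-- The free abelian sheaf on a terminal object is the constant sheaf `ℤ`. -/
noncomputable def freeIsoConstantSheaf {T : C} (hT : IsTerminal T) :
    (presheafToSheaf J AddCommGrpCat.{u}).obj (yoneda.obj T ⋙ AddCommGrpCat.free) ≅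
      (constantSheaf J AddCommGrpCat.{u}).obj (AddCommGrpCat.of (ULift ℤ)) :=
  (presheafToSheaf J AddCommGrpCat.{u}).mapIso (NatIso.ofComponents
    (fun W => 
      letI : Unique (W.unop ⟶ T) := ⟨⟨hT.from _⟩, fun _ => hT.hom_ext _ _⟩
      ((FreeAbelianGroup.uniqueEquiv (W.unop ⟶ T)).trans AddEquiv.ulift.symm).toAddCommGrpIso)
    (by
      intro W W' j
      refine free_hom_ext (X := W.unop ⟶ T) fun i => ?_
      apply ULift.ext
      change FreeAbelianGroup.lift (fun _ => (1 : ℤ))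
        (FreeAbelianGroup.map ((yoneda.obj T).map j) (FreeAbelianGroup.of i)) =
        FreeAbelianGroup.lift (fun _ => (1 : ℤ)) (FreeAbelianGroup.of i)
      rw [FreeAbelianGroup.map_of_apply, FreeAbelianGroup.lift_apply_of,
        FreeAbelianGroup.lift_apply_of]))

/-- A section over the intersection of two members of a Mayer-Vietoris square is a difference of
sections over the members, if the first cohomology of the union vanishes. -/
lemma exists_sub_eq_of_subsingleton_H [HasWeakSheafify J (Type u)]
    [HasExt.{u} (Sheaf J AddCommGrpCat.{u})]
    (S : J.MayerVietorisSquare) (hT : IsTerminal S.X₄) (F : Sheaf J AddCommGrpCat.{u})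
    [Subsingleton (F.H 1)] (s : F.obj.obj (op S.X₁)) :
    ∃ (a : F.obj.obj (op S.X₂)) (b : F.obj.obj (op S.X₃)),
      F.obj.map S.f₁₂.op a - F.obj.map S.f₁₃.op b = s := by
  obtain ⟨φ, rfl⟩ := evalFree_surjective F S.X₁ s
  have : Subsingleton (Ext S.shortComplex.X₃ F 1) :=
    subsingleton_ext_of_iso (freeIsoConstantSheaf (J := J) hT)
  -- The obstruction to extending `φ` from the intersection to the sum over the two members lies in
  -- `Ext¹` out of the constant sheaf `ℤ`, which is `H¹`.
  have h0 : S.shortComplex_shortExact.extClass.comp (Ext.mk₀ φ) (by rfl) =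
      (0 : Ext S.shortComplex.X₃ F 1) := Subsingleton.elim _ _
  obtain ⟨x, hx⟩ := Ext.contravariant_sequence_exact₁ S.shortComplex_shortExact _ _ _ h0
  obtain ⟨ψ, rfl⟩ := (Ext.mk₀_bijective _ _).2 x
  rw [Ext.mk₀_comp_mk₀] at hx
  have hx := (Ext.mk₀_bijective _ _).1 hx
  refine ⟨evalFree F _ (biprod.inl ≫ ψ), evalFree F _ (biprod.inr ≫ ψ), ?_⟩
  rw [← evalFree_map, ← evalFree_map, sub_eq_add_neg, ← evalFree_neg, ← evalFree_add, ← hx]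
  congr 1
  exact ((biprod_lift_comp _ _ ψ).trans (congrArg _ (Preadditive.neg_comp _ _))).symm

end Site


variable {K : Type u} [Field K]

lemma subsingleton_H_of_genus_eq_zero {X : Over (Spec (.of K))} (hX : genus X = 0) :
    Subsingleton ((structureAbSheaf X.left).H 1) :=
  letI := cohomologyModule X 1
  rank_zero_iff.1 hX

/-- The space is Noetherian, so `Z` is a finite union of irreducible closed sets; the generic point
of each differs from that of the curve and is therefore closed. -/
lemma finite_of_isClosed [PerfectField K] (X : Over (Spec (.of K)))
    [IsIntegral X.left] [IsProper X.hom] [SmoothOfRelativeDimension 1 X.hom] {Z : Set X.left}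
    (hZ : IsClosed Z) (h : genericPoint X.left ∉ Z) : Z.Finite := by
  have : IsLocallyNoetherian X.left := LocallyOfFiniteType.isLocallyNoetherian X.hom
  have : CompactSpace X.left := QuasiCompact.compactSpace_of_compactSpace X.hom
  have : IsNoetherian X.left := {}
  obtain ⟨S, hS, hc, hi, rfl⟩ :=
    TopologicalSpace.NoetherianSpace.exists_finite_set_isClosed_irreducible hZ
  refine hS.sUnion fun t ht => ?_
  obtain ⟨z, hz⟩ := QuasiSober.sober (hi t ht) (hc t ht)
  have hz' : z ≠ genericPoint X.left := fun e => h ⟨t, ht, e ▸ hz.mem⟩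
  rw [IsGenericPoint, (isClosed_singleton X.hom z hz').closure_eq] at hz
  rw [← hz]
  exact Set.finite_singleton z

/-- If `H¹(X, 𝒪_X) = 0`, then every principal part at a closed point is that of a function regular
at all other closed points. -/
lemma exists_regular_away [PerfectField K] (X : Over (Spec (.of K)))
    [IsIntegral X.left] [IsProper X.hom] [SmoothOfRelativeDimension 1 X.hom]
    [Subsingleton ((structureAbSheaf X.left).H 1)]
    (p : Place X) (g : X.left.functionField) :
    ∃ h, (∀ q : Place X, q ≠ p → h ∈ localRing X q.1) ∧ g - h ∈ localRing X p.1 := by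
  obtain ⟨W, hη, s, hs⟩ := X.left.presheaf.exists_germ_eq g
  have hp : IsClosed {p.1} := isClosed_singleton X.hom p.1 p.2
  have hW : ((W : Set X.left)ᶜ \ {p.1}).Finite :=
    (finite_of_isClosed X W.isOpen.isClosed_compl (fun h => h hη)).subset Set.sdiff_subset
  have hWc : IsClosed ((W : Set X.left)ᶜ \ {p.1}) := by
    rw [← Set.biUnion_of_singleton ((W : Set X.left)ᶜ \ {p.1})]
    exact hW.isClosed_biUnion fun z hz => isClosed_singleton X.hom z fun e => hz.1 (e ▸ hη)
  -- Here `U` omits `p`, and `V` omits the finitely many other points outside `W`. They cover the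
  -- curve, and `g` is regular on `U ⊓ V`. In `g = a - b`, the section `a` over `U` is the required
  -- function, and `b` is regular at `p`.
  let U : X.left.Opens := ⟨{p.1}ᶜ, hp.isOpen_compl⟩
  let V : X.left.Opens := ⟨_, hWc.isOpen_compl⟩
  have hpV : p.1 ∈ V := fun h => h.2 rfl
  have hηU : genericPoint X.left ∈ U := fun h => p.2 h.symm
  have hηV : genericPoint X.left ∈ V := fun h => h.1 hη
  have : Nonempty U := ⟨_, hηU⟩
  have : Nonempty V := ⟨_, hηV⟩
  have : Nonempty (U ⊓ V : X.left.Opens) := ⟨_, hηU, hηV⟩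
  obtain ⟨t, ht⟩ := exists_section X (U := U ⊓ V) (g := g) fun x hx => by
    have hxW : x ∈ W := by
      by_contra h
      exact hx.2 ⟨h, hx.1⟩
    rw [← hs]
    have : Nonempty W := ⟨_, hη⟩
    exact germToFunctionField_mem_localRing X s hxW
  obtain ⟨(a : Γ(X.left, U)), (b : Γ(X.left, V)), hab⟩ :=
    exists_sub_eq_of_subsingleton_H (Opens.mayerVietorisSquare U V)
    (IsTerminal.ofUniqueHom (fun Y => homOfLE fun y _ => by
      by_cases h : y = p.1
      · exact Or.inr (h ▸ hpV)
      · exact Or.inl h) (fun _ _ => Subsingleton.elim _ _))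
    (structureAbSheaf X.left) t
  replace hab : X.left.presheaf.map (homOfLE inf_le_left : U ⊓ V ⟶ U).op a -
    X.left.presheaf.map (homOfLE inf_le_right : U ⊓ V ⟶ V).op b = t := hab
  have hg : X.left.germToFunctionField U a - X.left.germToFunctionField V b = g := by
    rw [← ht, ← hab, map_sub]
    congr 1 <;> exact (TopCat.Presheaf.germ_res_apply ..).symm
  refine ⟨X.left.germToFunctionField U a, fun q hq =>
    germToFunctionField_mem_localRing X _ fun h => hq (Subtype.ext h), ?_⟩
  rw [← hg, sub_sub_cancel_left]
  exact neg_mem (germToFunctionField_mem_localRing X b hpV)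

/-- The local rings of a smooth projective curve of genus zero form a genus zero model. -/
lemma isGenusZeroModel [PerfectField K] (X : Over (Spec (.of K)))
    [IsSmoothProjectiveCurve X] [SmoothOfRelativeDimension 1 X.hom] (hX : genus X = 0) :
    IsGenusZeroModel (K := K) (fun p : Place X => localRing X p.1) := by
  have := IsSmoothProjectiveCurve.isProper (X := X)
  have := IsSmoothProjectiveCurve.geometricallyConnected (X := X)
  have := subsingleton_H_of_genus_eq_zero hX
  exact
  { isFractionRing := fun p => isFractionRing_localRing X p.1
    finite := fun p => finite_residueField_localRing X p
    const := fun g hg => mem_range_of_forall_mem_localRing X hg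
    principalPart := exists_regular_away X
    proper := fun R hK hR => exists_place_of_valuationSubring X R hK hR }

end CurveModel

/-! ### Recovering curves from their function fields -/

namespace CurveModel

open IsLocalRing Module

lemma fromFunctionField_eq {X Y : Scheme.{u}} [IrreducibleSpace X] (g : X.PartialMap Y) {x : X}
    (hx : x ∈ g.domain) :
    g.fromFunctionField = Spec.map (X.presheaf.stalkSpecializes (genericPoint_specializes x)) ≫
      g.fromSpecStalkOfMem hx := by
  rw [Scheme.PartialMap.fromFunctionField, Scheme.PartialMap.fromSpecStalkOfMem,
    Scheme.PartialMap.fromSpecStalkOfMem, ← Category.assoc]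
  congr 1
  rw [← cancel_mono g.domain.ι, Category.assoc, Scheme.Opens.fromSpecStalkOfMem_ι,
    Scheme.Opens.fromSpecStalkOfMem_ι, Scheme.SpecMap_stalkSpecializes_fromSpecStalk]

/-- The generic point is dense, the source is reduced and the target is separated. -/
lemma hom_ext_of_genericPoint {X Y : Scheme.{u}} [IsIntegral X] [Y.IsSeparated] {f g : X ⟶ Y}
    (h : X.fromSpecStalk (genericPoint X) ≫ f = X.fromSpecStalk (genericPoint X) ≫ g) :
    f = g := by
  have : IsDominant (X.fromSpecStalk (genericPoint X)) := by
    constructor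
    rw [DenseRange, Scheme.range_fromSpecStalk]
    refine Dense.mono (Set.singleton_subset_iff.2 (specializes_refl _)) ?_
    rw [dense_iff_closure_eq]
    exact genericPoint_spec X
  exact ext_of_isDominant (X.fromSpecStalk (genericPoint X)) h

variable {K : Type u} [Field K]

lemma valuationRing_stalk [PerfectField K] (X : Over (Spec (.of K)))
    [IsIntegral X.left] [SmoothOfRelativeDimension 1 X.hom] (x : X.left) :
    ValuationRing (X.left.presheaf.stalk x) := by
  by_cases hx : IsField (X.left.presheaf.stalk x)
  · let _ := hx.toField
    exact ValuationRing.of_field _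
  · have := isDiscreteValuationRing_stalk X.hom x hx
    infer_instance

lemma isSeparated_left (X : Over (Spec (.of K))) [IsProper X.hom] : X.left.IsSeparated := by
  constructor
  rw [← Limits.terminal.comp_from X.hom]
  infer_instance

/-- A point of a proper scheme over the function field of a smooth curve extends to a morphism. -/
lemma exists_hom_of_functionField [PerfectField K] (X Y : Over (Spec (.of K)))
    [IsIntegral X.left] [SmoothOfRelativeDimension 1 X.hom] [IsProper Y.hom]
    (φ : Spec X.left.functionField ⟶ Y.left)
    (hφ : φ ≫ Y.hom = X.left.fromSpecStalk (genericPoint X.left) ≫ X.hom) :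
    ∃ f : X ⟶ Y, X.left.fromSpecStalk (genericPoint X.left) ≫ f.left = φ := by
  have := isSeparated_left Y
  let r := Scheme.RationalMap.ofFunctionField X.hom Y.hom φ hφ
  have hr : r.fromFunctionField = φ := Scheme.RationalMap.fromFunctionField_ofFunctionField ..
  -- At each `x` the local ring is a valuation ring, so the valuative criterion extends the map to
  -- the spectrum of the stalk, and this spreads out to a neighbourhood of `x`.
  have hd : r.domain = ⊤ := by
    rw [eq_top_iff]
    intro x _
    rw [Scheme.RationalMap.mem_domain]
    have := valuationRing_stalk X x
    have : IsScalarTower K (X.left.presheaf.stalk x) X.left.functionField :=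
      .of_algebraMap_eq fun c => ((stalkToFunctionField X x).commutes c).symm
    obtain ⟨l, hl, hl'⟩ := exists_lift Y (R := X.left.presheaf.stalk x)
      (L := X.left.functionField) φ (hφ.trans (fromSpecStalk_hom X _))
    have hl'' := hl'.trans (fromSpecStalk_hom X x).symm
    have hx := Scheme.PartialMap.mem_domain_ofFromSpecStalk X.hom Y.hom l hl''
    refine ⟨_, hx, Scheme.RationalMap.eq_of_fromFunctionField_eq _ _ ?_⟩
    rw [hr, Scheme.RationalMap.fromFunctionField_toRationalMap, fromFunctionField_eq _ hx,
      Scheme.PartialMap.fromSpecStalkOfMem_ofFromSpecStalk]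
    exact hl
  obtain ⟨m, hm⟩ : ∃ m : X.left ⟶ Y.left, r = m.toRationalMap := by
    rw [← r.toRationalMap_toPartialMap]
    have : r.toPartialMap.domain = ⊤ := hd
    generalize r.toPartialMap = P at this
    obtain ⟨U, hU, p⟩ := P
    obtain rfl : U = ⊤ := this
    refine ⟨X.left.topIso.inv ≫ p, ?_⟩
    congr 1
    change (⟨⊤, hU, p⟩ : X.left.PartialMap Y.left) =
      ⟨⊤, dense_univ, X.left.topIso.hom ≫ X.left.topIso.inv ≫ p⟩
    rw [Iso.hom_inv_id_assoc]
  have hm' : X.left.fromSpecStalk (genericPoint X.left) ≫ m = φ := by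
    rw [← hr, hm, Scheme.RationalMap.fromFunctionField_toRationalMap]
    exact (Scheme.PartialMap.fromSpecStalkOfMem_toPartialMap m _).symm
  refine ⟨Over.homMk m (hom_ext_of_genericPoint ?_), hm'⟩
  rw [← hφ, ← hm', Category.assoc]

variable (X Y : Over (Spec (.of K))) [IsIntegral X.left] [IsIntegral Y.left]

lemma exists_hom_of_algEquiv [PerfectField K] [IsProper X.hom] [SmoothOfRelativeDimension 1 Y.hom]
    (e : X.left.functionField ≃ₐ[K] Y.left.functionField) :
    ∃ f : Y ⟶ X, Y.left.fromSpecStalk (genericPoint Y.left) ≫ f.left =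
      Spec.map (CommRingCat.ofHom (e : X.left.functionField →+* Y.left.functionField)) ≫
        X.left.fromSpecStalk (genericPoint X.left) := by
  refine exists_hom_of_functionField Y X _ ?_
  rw [Category.assoc, fromSpecStalk_hom, fromSpecStalk_hom, ← Spec.map_comp]
  congr 1
  ext c
  exact e.commutes c

variable {X Y} in
lemma comp_eq_id_of_algEquiv [IsProper Y.hom]
    (e : X.left.functionField ≃ₐ[K] Y.left.functionField)
    {f : Y ⟶ X} {g : X ⟶ Y}
    (hf : Y.left.fromSpecStalk (genericPoint Y.left) ≫ f.left =
      Spec.map (CommRingCat.ofHom (e : X.left.functionField →+* Y.left.functionField)) ≫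
        X.left.fromSpecStalk (genericPoint X.left))
    (hg : X.left.fromSpecStalk (genericPoint X.left) ≫ g.left =
      Spec.map (CommRingCat.ofHom (e.symm : Y.left.functionField →+* X.left.functionField)) ≫
        Y.left.fromSpecStalk (genericPoint Y.left)) : f ≫ g = 𝟙 Y := by
  have := isSeparated_left Y
  apply Over.OverMorphism.ext
  apply hom_ext_of_genericPoint
  rw [Over.comp_left, ← Category.assoc, hf, Category.assoc, hg, ← Category.assoc,
    Over.id_left, Category.comp_id]
  have h : CommRingCat.ofHom (e.symm : Y.left.functionField →+* X.left.functionField) ≫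
      CommRingCat.ofHom (e : X.left.functionField →+* Y.left.functionField) = 𝟙 _ := by
    ext c
    exact e.apply_symm_apply c
  exact (congrArg (· ≫ _) ((Spec.map_comp _ _).symm.trans
    ((congrArg Spec.map h).trans (Spec.map_id _)))).trans (Category.id_comp _)

/-- Smooth proper curves with isomorphic function fields are isomorphic. -/
lemma nonempty_iso_of_functionField [PerfectField K] [SmoothOfRelativeDimension 1 X.hom]
    [IsProper X.hom] [SmoothOfRelativeDimension 1 Y.hom] [IsProper Y.hom]
    (e : X.left.functionField ≃ₐ[K] Y.left.functionField) : Nonempty (X ≅ Y) := by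
  obtain ⟨f, hf⟩ := exists_hom_of_algEquiv X Y e
  obtain ⟨g, hg⟩ := exists_hom_of_algEquiv Y X e.symm
  exact ⟨g, f, comp_eq_id_of_algEquiv e.symm hg hf, comp_eq_id_of_algEquiv e hf hg⟩

end CurveModel

/-! ### Morphisms of curves and the conclusion -/

namespace CurveModel

open IsLocalRing Module

variable {K : Type u} [Field K]

section Field

variable {F : Type*} [Field F] [Algebra K F]

/-- Completing the square in the relation `x² = c + d x` of a generator. -/
lemma exists_sq_eq_of_finrank_two (h2 : (2 : K) ≠ 0) (hF : finrank K F = 2) :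
    ∃ (s : F) (a : K), s ∉ (algebraMap K F).range ∧ s ^ 2 = algebraMap K F a := by
  have : Module.Finite K F := Module.finite_of_finrank_eq_succ hF
  obtain ⟨x, hx⟩ : ∃ x, x ∉ (algebraMap K F).range := by
    by_contra! h
    have : Function.Surjective (algebraMap K F) := h
    have := Algebra.finrank_eq_one_iff_bijective_algebraMap.2 ⟨(algebraMap K F).injective, this⟩
    omega
  have hli : LinearIndependent K ![1, x] := by
    rw [LinearIndependent.pair_iff' one_ne_zero]
    intro c hc
    exact hx ⟨c, by rw [← hc, Algebra.algebraMap_eq_smul_one]⟩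
  have htop := hli.span_eq_top_of_card_eq_finrank' (by simp [hF])
  have hx2 : x ^ 2 ∈ Submodule.span K (Set.range ![1, x]) := htop ▸ Submodule.mem_top
  rw [Matrix.range_cons, Matrix.range_cons, Matrix.range_empty, Set.union_empty,
    Set.singleton_union, Submodule.mem_span_pair] at hx2
  obtain ⟨c, d, hcd⟩ := hx2
  rw [Algebra.smul_def, Algebra.smul_def, mul_one] at hcd
  refine ⟨x - algebraMap K F (d / 2), c + (d / 2) ^ 2, fun ⟨e, he⟩ => hx ⟨e + d / 2, ?_⟩, ?_⟩
  · rw [map_add, he, sub_add_cancel]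
  · have hd : algebraMap K F d = 2 * algebraMap K F (d / 2) := by
      rw [← map_ofNat (algebraMap K F) 2, ← map_mul, mul_div_cancel₀ d h2]
    rw [map_add, map_pow, sub_sq, ← hcd, hd]
    ring

end Field

section Stalk

variable {X Y : Over (Spec (.of K))} (f : X ⟶ Y)

lemma constants_comp (c : K) : f.left.appTop (constants Y c) = constants X c := by
  have h : Y.hom.appTop ≫ f.left.appTop = X.hom.appTop := by
    rw [← Scheme.Hom.comp_appTop, Over.w]
  exact congrArg (fun φ => φ.hom ((Scheme.ΓSpecIso (.of K)).inv c)) h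

/-- The homomorphism of local rings given by a morphism over `K`. -/
noncomputable def stalkHom (x : X.left) :
    Y.left.presheaf.stalk (f.left x) →ₐ[K] X.left.presheaf.stalk x where
  toRingHom := (f.left.stalkMap x).hom
  commutes' c := by
    change f.left.stalkMap x (Y.left.presheaf.germ ⊤ (f.left x) trivial (constants Y c)) = _
    rw [algebraMap_stalk, ← constants_comp f]
    exact Scheme.Hom.germ_stalkMap_apply f.left ⊤ x trivial _

instance (x : X.left) : IsLocalHom (stalkHom f x) :=
  ⟨fun a ha => isUnit_of_map_unit (f.left.stalkMap x).hom a ha⟩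

/-- The isomorphism of local rings given by an equality of points. -/
noncomputable def stalkEquivOfEq {x y : X.left} (h : x = y) :
    X.left.presheaf.stalk x ≃ₐ[K] X.left.presheaf.stalk y := by
  subst h
  exact AlgEquiv.refl

end Stalk

section Points

variable (X : Over (Spec (.of K)))

/-- A homomorphism from a local ring to `K` gives a rational point. -/
lemma nonempty_rationalPoint (x : X.left) (ρ : X.left.presheaf.stalk x →ₐ[K] K) :
    Nonempty (RationalPoint X) := by
  refine ⟨Over.homMk (Spec.map (CommRingCat.ofHom (ρ : X.left.presheaf.stalk x →+* K)) ≫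
    X.left.fromSpecStalk x) ?_⟩
  change _ = 𝟙 _
  have h : CommRingCat.ofHom (algebraMap K (X.left.presheaf.stalk x)) ≫
      CommRingCat.ofHom (ρ : X.left.presheaf.stalk x →+* K) = 𝟙 _ := by
    ext c
    exact ρ.commutes c
  rw [Category.assoc, fromSpecStalk_hom, ← Spec.map_comp]
  exact (congrArg Spec.map h).trans (Spec.map_id _)

lemma finrank_residueField_ne_one (h : IsEmpty (RationalPoint X)) (x : X.left) :
    finrank K (ResidueField (X.left.presheaf.stalk x)) ≠ 1 := by
  intro h1
  obtain ⟨e⟩ := nonempty_algEquiv_iff_finrank_eq_one.2 h1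
  obtain ⟨p⟩ := nonempty_rationalPoint X x
    (e.symm.toAlgHom.comp (IsScalarTower.toAlgHom K _ _))
  exact h.false p

variable [IsIntegral X.left] [PerfectField K] [SmoothOfRelativeDimension 1 X.hom]

/-- The residue field of a local ring in terms of its image in the function field. -/
noncomputable def residueFieldEquiv (p : Place X) :
    ResidueField (X.left.presheaf.stalk p.1) ≃ₐ[K] ResidueField (localRing X p.1) :=
  ResidueField.mapAlgEquiv (stalkEquiv X p.1)

lemma finrank_residueField_localRing_ne_one (h : IsEmpty (RationalPoint X)) (p : Place X) :
    finrank K (ResidueField (localRing X p.1)) ≠ 1 := by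
  rw [← (residueFieldEquiv X p).toLinearEquiv.finrank_eq]
  exact finrank_residueField_ne_one X h p.1

lemma not_isIntegral_functionField (p : Place X) :
    ¬Algebra.IsIntegral K X.left.functionField := by
  intro h
  have : Algebra.IsIntegral (localRing X p.1) X.left.functionField := .tower_top K
  exact IsDiscreteValuationRing.not_isField (localRing X p.1)
    (isField_of_isIntegral_of_isField Subtype.val_injective (Field.toIsField _))

end Points

section Curves

variable [PerfectField K] {X Y : Over (Spec (.of K))} [IsIntegral X.left] [IsIntegral Y.left]
  [SmoothOfRelativeDimension 1 X.hom] [SmoothOfRelativeDimension 1 Y.hom] {f : X ⟶ Y}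

omit [SmoothOfRelativeDimension 1 X.hom] in
/-- A nonconstant morphism of curves is dominant. -/
lemma map_genericPoint (hf : IsNonconstant f) :
    f.left (genericPoint X.left) = genericPoint Y.left := by
  by_contra h
  refine hf ⟨f.left (genericPoint X.left), fun x => ?_⟩
  have hx := (genericPoint_specializes x).map f.left.continuous
  rw [specializes_iff_mem_closure, (isClosed_singleton Y.hom _ h).closure_eq] at hx
  exact hx

omit [PerfectField K] [IsIntegral X.left] [SmoothOfRelativeDimension 1 X.hom]
  [SmoothOfRelativeDimension 1 Y.hom] in
lemma exists_place_target (hf : IsNonconstant f) : Nonempty (Place Y) := by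
  by_contra h
  refine hf ⟨genericPoint Y.left, fun x => ?_⟩
  by_contra hx
  exact h ⟨f.left x, hx⟩

omit [PerfectField K] [IsIntegral Y.left] [SmoothOfRelativeDimension 1 X.hom]
  [SmoothOfRelativeDimension 1 Y.hom] in
lemma exists_place_source (hf : IsNonconstant f) : Nonempty (Place X) := by
  by_contra h
  refine hf ⟨f.left (genericPoint X.left), fun x => ?_⟩
  by_contra hx
  exact h ⟨x, fun e => hx (congrArg _ e)⟩

/-- Otherwise the function field of `Y` would embed in a residue field finite over `K`, whereas it
is not algebraic. -/
lemma map_place_ne (hf : IsNonconstant f) (p : Place X) : f.left p.1 ≠ genericPoint Y.left := by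
  intro h
  obtain ⟨q⟩ := exists_place_target hf
  apply not_isIntegral_functionField Y q
  have := finite_residueField_localRing X p
  have : Module.Finite K (ResidueField (X.left.presheaf.stalk p.1)) :=
    .equiv (residueFieldEquiv X p).symm.toLinearEquiv
  let φ : Y.left.functionField →ₐ[K] ResidueField (X.left.presheaf.stalk p.1) :=
    ((IsScalarTower.toAlgHom K _ _).comp (stalkHom f p.1)).comp
      (stalkEquivOfEq h).symm.toAlgHom
  exact .of_injective φ φ.toRingHom.injective

/-- The image of a closed point under a nonconstant morphism of curves. -/
noncomputable def mapPlace (hf : IsNonconstant f) (p : Place X) : Place Y :=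
  ⟨f.left p.1, map_place_ne hf p⟩

/-- The homomorphism of residue fields given by a nonconstant morphism of curves. -/
noncomputable def residueFieldHom (hf : IsNonconstant f) (p : Place X) :
    ResidueField (localRing Y (mapPlace hf p).1) →ₐ[K] ResidueField (localRing X p.1) :=
  ((residueFieldEquiv X p).toAlgHom.comp (ResidueField.mapAlgHom (stalkHom f p.1))).comp
    (residueFieldEquiv Y (mapPlace hf p)).symm.toAlgHom

/-- The homomorphism of function fields given by a nonconstant morphism of curves. -/
noncomputable def functionFieldHom (hf : IsNonconstant f) :
    Y.left.functionField →ₐ[K] X.left.functionField :=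
  (stalkHom f (genericPoint X.left)).comp (stalkEquivOfEq (map_genericPoint hf)).symm.toAlgHom

omit [SmoothOfRelativeDimension 1 X.hom] in
lemma curveDegree_eq (hf : IsNonconstant f) :
    letI := (functionFieldHom hf).toRingHom.toAlgebra
    curveDegree f = finrank Y.left.functionField X.left.functionField := by
  let _ := (functionFieldHom hf).toRingHom.toAlgebra
  let _ : Algebra (Y.left.presheaf.stalk (f.left (genericPoint X.left))) X.left.functionField :=
    (f.left.stalkMap (genericPoint X.left)).hom.toAlgebra
  refine Algebra.finrank_eq_of_equiv_equiv
    (stalkEquivOfEq (K := K) (map_genericPoint hf)).toRingEquiv (RingEquiv.refl _) ?_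
  ext a
  change f.left.stalkMap (genericPoint X.left) ((stalkEquivOfEq (map_genericPoint hf)).symm
    (stalkEquivOfEq (map_genericPoint hf) a)) = f.left.stalkMap (genericPoint X.left) a
  rw [AlgEquiv.symm_apply_apply]

end Curves

/-- A nonconstant morphism between curves of genus zero, the target of which has no rational
points, has odd degree, and the curves are isomorphic. -/
theorem nonempty_iso_and_odd_curveDegree [PerfectField K] (h2 : (2 : K) ≠ 0)
    {X Y : Over (Spec (.of K))} [IsSmoothProjectiveCurve X] [IsSmoothProjectiveCurve Y]
    (hX : genus X = 0) (hY : genus Y = 0) (f : X ⟶ Y) (hf : IsNonconstant f)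
    (hpt : IsEmpty (RationalPoint Y)) : Nonempty (X ≅ Y) ∧ Odd (curveDegree f) := by
  have := IsSmoothProjectiveCurve.isProper (X := X)
  have := IsSmoothProjectiveCurve.isProper (X := Y)
  have := IsSmoothProjectiveCurve.smooth (X := X)
  have := IsSmoothProjectiveCurve.smooth (X := Y)
  have hptX : IsEmpty (RationalPoint X) := ⟨fun p => hpt.false (p ≫ f)⟩
  have hOX := isGenusZeroModel X hX
  have hOY := isGenusZeroModel Y hY
  obtain ⟨p₀⟩ := exists_place_source hf
  obtain ⟨t₀, ht₀⟩ := IsDiscreteValuationRing.exists_irreducible (localRing X p₀.1)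
  obtain ⟨p, hp⟩ := exists_place_finrank_two hOX ht₀
    (finrank_residueField_localRing_ne_one X hptX)
  obtain ⟨t, ht⟩ := IsDiscreteValuationRing.exists_irreducible (localRing X p.1)
  have := hOX.finite p
  have := hOY.finite (mapPlace hf p)
  -- The residue field of the image embeds in a field of degree 2 and does not have degree 1.
  have hq : finrank K (ResidueField (localRing Y (mapPlace hf p).1)) = 2 := by
    have h1 := finrank_residueField_localRing_ne_one Y hpt (mapPlace hf p)
    have h0 : 0 < finrank K (ResidueField (localRing Y (mapPlace hf p).1)) := finrank_pos
    have hle := LinearMap.finrank_le_finrank_of_injective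
      (f := (residueFieldHom hf p).toLinearMap) (residueFieldHom hf p).toRingHom.injective
    omega
  obtain ⟨t', ht'⟩ := IsDiscreteValuationRing.exists_irreducible (localRing Y (mapPlace hf p).1)
  obtain ⟨s', a, hs', hsa'⟩ := exists_sq_eq_of_finrank_two h2 hq
  obtain ⟨b', x', y', h', hb'⟩ := exists_isConic hOY ht' h2 hq hs' hsa'
  -- The square root chosen on the target is transported to the source, so that both conics have the
  -- same coefficient `a`.
  obtain ⟨b, x, y, h, -⟩ := exists_isConic hOX ht h2 hp (s := residueFieldHom hf p s') (a := a)
    (by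
      rintro ⟨c, hc⟩
      rw [← AlgHom.commutes (residueFieldHom hf p)] at hc
      exact hs' ⟨c, (residueFieldHom hf p).toRingHom.injective hc⟩)
    (by rw [← map_pow, hsa', AlgHom.commutes])
  rw [curveDegree_eq hf]
  let _ := (functionFieldHom hf).toRingHom.toAlgebra
  have : IsScalarTower K Y.left.functionField X.left.functionField :=
    .of_algebraMap_eq fun c => ((functionFieldHom hf).commutes c).symm
  obtain ⟨hodd, ⟨e⟩⟩ := h.odd_finrank h' h2 fun hxy => by
    obtain ⟨q, hq⟩ := hb' hxy
    exact finrank_residueField_localRing_ne_one Y hpt q hq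
  exact ⟨nonempty_iso_of_functionField X Y e.symm, hodd⟩

end CurveModel

theorem mainTheorem10 {K : Type u} [Field K] [NumberField K]
    (C C' : Over (Spec (.of K)))
    [IsSmoothProjectiveCurve C] [IsSmoothProjectiveCurve C']
    (hC : genus C = 0) (hC' : genus C' = 0)
    (f : C ⟶ C') (hf : IsNonconstant f)
    (hpt : IsEmpty (RationalPoint C')) :
    Nonempty (C ≅ C') ∧ Odd (curveDegree f) :=
  CurveModel.nonempty_iso_and_odd_curveDegree two_ne_zero hC hC' f hf hpt
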